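/- **Setting.** Let $G_0$ be the complete graph on $\{(0,0),(1,0),(0,1)\}\subset\mathbb{Z}^2$ and let $G_{k+1}=\bigcup_{i=0}^{2}(G_k+a_{k,i})$ with $a_{k,0}=(0,0)$, $a_{k,1}=(2^k,0)$, $a_{k,2}=(0,2^k)$. Put $\mathsf{SG}^+=\bigcup_{k\ge 0}G_k$, and let $\mathsf{SG}=\mathsf{SG}^+\cup(-\mathsf{SG}^+)$ be the double-sided Sierpinski gasket graph (which is $4$-regular), with origin $o=(0,0)$, neighbourhood relation $\sim$, and balls $B_n$ of radius $n$ around $o$ in the graph metric (that is, $B_n=\{(x,y)\in\mathsf{SG}:|x|+|y|\le n\}$). For $f:\mathsf{SG}\to\mathbb{R}$ let $\Delta f(x)=\frac14\sum_{y\sim x}f(y)-f(x)$. Divisible sandpile (with maximal height $1$): for $\mu:\mathsf{SG}\to\mathbb{R}_{\ge 0}$ of finite support, toppling the vertex $x$ gives $T_x\mu=\mu+\max\{\mu(x)-1,0\}\,\Delta\delta_x$. Given an initial distribution $\mu_0$ and a sequence $(x_j)_{j\ge 1}$ of vertices that contains every vertex infinitely often (a toppling sequence), put $\mu_n=T_{x_n}\mu_{n-1}$;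 the odometer after $n$ topplings is the total mass emitted from each vertex, $y\mapsto\sum_{1\le j\le n,\;x_j=y}\big(\mu_{j-1}(y)-\mu_j(y)\big)$. The odometer function $u$ is the pointwise limit of these functions as $n\to\infty$; it does not depend on the toppling sequence. The sandpile cluster is $\{z\in\mathsf{SG}:u(z)>0\}$. **Theorem.** There is exactly one function $\tilde u:\mathsf{SG}^+\to\mathbb{R}$ such that $\tilde u(x,0)=0$ for all integers $x\ge 0$, $\tilde u(x,1)=2$ for all $x\ge 0$ with $(x,1)\in\mathsf{SG}^+$, and $\Delta\tilde u(x,y)=1$ for all $(x,y)\in\mathsf{SG}^+$ with $y\ge 1$ (all neighbours of such a vertex lie in $\mathsf{SG}^+$). For every integer $k\ge 0$ let $\psi_k(x,y)=(y,\,2^k-x-y)$. Then for every $k\ge 0$ the odometer function $u_k$ of the divisible sandpile on $\mathsf{SG}$ with initial mass distribution $\mu_0=3^{k+1}\delta_o$ exists (the limit exists for every toppling sequence, and is the same for all of them), and $$u_k(x,y)=\begin{cases}\tilde u\big(\psi_k(|x|,|y|)\big),&\text{if }(x,y)\in B_{2^k},\\ 0,&\text{otherwise.}\end{cases}$$ Moreover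 the sandpile cluster $\{z\in\mathsf{SG}:u_k(z)>0\}$ is equal to $B_{2^k-1}$. -/

import Mathlib

open Filter Topology

/-- The translation vectors `(0,0)`, `(2^k,0)`, `(0,2^k)`. -/
def gasketShift (k : ℕ) : Fin 3 → ℤ × ℤ :=
  ![(0, 0), ((2 : ℤ) ^ k, 0), (0, (2 : ℤ) ^ k)]

/-- The vertex set of the finite gasket graph `G_k`. -/
def gasketLevelVertices : ℕ → Set (ℤ × ℤ)
  | 0 => {(0, 0), (1, 0), (0, 1)}
  | k + 1 => ⋃ i : Fin 3, (fun z => z + gasketShift k i) '' gasketLevelVertices k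

/-- The edges of the finite gasket graph `G_k`, as a graph on the whole of `ℤ × ℤ`: `G_0` is the
complete graph on its three vertices, and `G_{k+1}` is the union of three translates of `G_k`. -/
def gasketLevel : ℕ → SimpleGraph (ℤ × ℤ)
  | 0 =>
    { Adj := fun u v => u ∈ gasketLevelVertices 0 ∧ v ∈ gasketLevelVertices 0 ∧ u ≠ v
      symm := ⟨fun _ _ h => ⟨h.2.1, h.1, h.2.2.symm⟩⟩
      loopless := ⟨fun _ h => h.2.2 rfl⟩ }
  | k + 1 => ⨆ i : Fin 3, (gasketLevel k).map (Equiv.addRight (gasketShift k i)).toEmbedding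

/-- The vertex set of the one-sided gasket `SG⁺`. -/
def gasketPlus : Set (ℤ × ℤ) := ⋃ k, gasketLevelVertices k

/-- The vertex set of the double-sided gasket `SG = SG⁺ ∪ (-SG⁺)`. -/
def gasketSet : Set (ℤ × ℤ) := {z | z ∈ gasketPlus ∨ -z ∈ gasketPlus}

/-- The vertices of the double-sided gasket, as a type. -/
abbrev Gasket : Type := ↥gasketSet

/-- The double-sided Sierpinski gasket graph `SG`: the union of `SG⁺` and of its mirror image. -/
def gasketGraph : SimpleGraph Gasket where
  Adj u v := (∃ k, (gasketLevel k).Adj u v) ∨ (∃ k, (gasketLevel k).Adj (-u) (-v))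
  symm := ⟨fun _ _ h => h.imp (fun ⟨k, h⟩ => ⟨k, h.symm⟩) (fun ⟨k, h⟩ => ⟨k, h.symm⟩)⟩
  loopless := ⟨fun _ h => h.elim (fun ⟨k, h⟩ => (gasketLevel k).irrefl h)
    (fun ⟨k, h⟩ => (gasketLevel k).irrefl h)⟩

theorem gasketLevel_adj_bound (k : ℕ) : ∀ u v : ℤ × ℤ, (gasketLevel k).Adj u v →
    (u.1 - 1 ≤ v.1 ∧ v.1 ≤ u.1 + 1) ∧ (u.2 - 1 ≤ v.2 ∧ v.2 ≤ u.2 + 1) := by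
  induction k with
  | zero =>
    rintro ⟨a, b⟩ ⟨c, d⟩ ⟨h1, h2, -⟩
    simp only [gasketLevelVertices, Set.mem_insert_iff, Set.mem_singleton_iff,
      Prod.mk.injEq] at h1 h2
    simp only
    omega
  | succ k ih =>
    intro u v h
    simp only [gasketLevel, SimpleGraph.iSup_adj, SimpleGraph.map_adj] at h
    obtain ⟨i, a, b, hab, rfl, rfl⟩ := h
    have := ih a b hab
    simp only [Equiv.coe_toEmbedding, Equiv.coe_addRight, Prod.fst_add, Prod.snd_add]
    omega

theorem gasketGraph_neighborSet_finite (u : Gasket) : (gasketGraph.neighborSet u).Finite := by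
  refine Set.Finite.of_finite_image (f := Subtype.val) ?_ Subtype.val_injective.injOn
  refine ((Set.finite_Icc (u.1.1 - 1) (u.1.1 + 1)).prod
    (Set.finite_Icc (u.1.2 - 1) (u.1.2 + 1))).subset ?_
  rintro _ ⟨v, hv, rfl⟩
  rcases hv with ⟨k, h⟩ | ⟨k, h⟩
  · have := gasketLevel_adj_bound k _ _ h
    simp only [Set.mem_prod, Set.mem_Icc]
    omega
  · have := gasketLevel_adj_bound k _ _ h
    simp only [Prod.fst_neg, Prod.snd_neg] at this
    simp only [Set.mem_prod, Set.mem_Icc]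
    omega

noncomputable instance gasketGraph_locallyFinite : gasketGraph.LocallyFinite :=
  fun u => (gasketGraph_neighborSet_finite u).fintype

/-- The origin `o = (0,0)` of the gasket. -/
def gasketOrigin : Gasket :=
  ⟨(0, 0), Or.inl (Set.mem_iUnion.2 ⟨0, by simp [gasketLevelVertices]⟩)⟩

/-- The closed ball `B_n` around the origin in the graph metric of `SG`. -/
noncomputable def gasketBall (n : ℕ) : Set Gasket :=
  {z | gasketGraph.edist gasketOrigin z ≤ (n : ℕ∞)}

/-- The graph Laplacian `Δ f (x) = (1/4) ∑_{y ∼ x} f y - f x`. -/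
noncomputable def gasketLaplacian (f : Gasket → ℝ) (x : Gasket) : ℝ :=
  (1 / 4) * ∑ y ∈ gasketGraph.neighborFinset x, f y - f x

/-- The point mass `δ_x`. -/
noncomputable def gasketDelta (x : Gasket) : Gasket → ℝ := Pi.single x 1

/-- The toppling operator `T_x μ = μ + max (μ x - 1, 0) Δ δ_x` (maximal height `1`). -/
noncomputable def topple (x : Gasket) (μ : Gasket → ℝ) : Gasket → ℝ :=
  μ + max (μ x - 1) 0 • gasketLaplacian (gasketDelta x)

/-- The sand distribution after toppling `x 0, …, x (n-1)`, in this order. -/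
noncomputable def sandAfter (x : ℕ → Gasket) (μ₀ : Gasket → ℝ) : ℕ → Gasket → ℝ
  | 0 => μ₀
  | n + 1 => topple (x n) (sandAfter x μ₀ n)

/-- The total mass emitted from `y` during the topplings of `x 0, …, x (n-1)`. -/
noncomputable def odometerAfter (x : ℕ → Gasket) (μ₀ : Gasket → ℝ) (n : ℕ) (y : Gasket) : ℝ :=
  ∑ j ∈ (Finset.range n).filter (fun j => x j = y), (sandAfter x μ₀ j y - sandAfter x μ₀ (j + 1) y)

/-- A toppling sequence contains every vertex infinitely often. -/
def IsTopplingSequence (x : ℕ → Gasket) : Prop :=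
  ∀ z : Gasket, {n | x n = z}.Infinite

/-- `u` is the odometer function of the divisible sandpile started from `μ₀`: for every toppling
sequence, the odometers after finitely many topplings converge pointwise to `u`. -/
def IsOdometer (μ₀ u : Gasket → ℝ) : Prop :=
  ∀ x : ℕ → Gasket, IsTopplingSequence x →
    ∀ z, Tendsto (fun n => odometerAfter x μ₀ n z) atTop (𝓝 (u z))

/-- The sandpile cluster belonging to an odometer function. -/
def sandpileCluster (u : Gasket → ℝ) : Set Gasket := {z | 0 < u z}

/-- The conditions that define `ũ : SG⁺ → ℝ`. A function on `SG⁺` is written as a function on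
`ℤ × ℤ`, whose values off `SG⁺` play no role: all neighbours of a vertex of `SG⁺` other than the
origin lie in `SG⁺`. -/
structure IsUTilde (f : ℤ × ℤ → ℝ) : Prop where
  row_zero : ∀ x : ℤ, 0 ≤ x → f (x, 0) = 0
  row_one : ∀ x : ℤ, 0 ≤ x → (x, 1) ∈ gasketPlus → f (x, 1) = 2
  laplacian_eq_one : ∀ z : Gasket, (z : ℤ × ℤ) ∈ gasketPlus → 1 ≤ (z : ℤ × ℤ).2 →
    gasketLaplacian (fun w : Gasket => f w) z = 1

/-- `ψ_k (x, y) = (y, 2^k - x - y)`. -/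
def gasketPsi (k : ℕ) (z : ℤ × ℤ) : ℤ × ℤ := (z.2, 2 ^ k - z.1 - z.2)

/-! Two facts are combined: a characterization of odometers, and an exact self-similarity of `ũ`.

Odometer. After finitely many topplings the sand is `μ₀ + Δ(odometer)`. By least action
(`odometerAfter_le`) odometers stay below every nonnegative `u` with `μ₀ + Δu ≤ 1`. They increase,
so they have a limit `v ≤ u`, and `μ₀ + Δv ≤ 1` because every vertex topples infinitely often. If
`μ₀ + Δu = 1` on the finite set `{u > 0}`, then `u - v` is subharmonic there and nonpositive
elsewhere, so `u = v` by the maximum principle. This is `isOdometer_of_stabilizing`; it remains to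
verify these conditions for the claimed `u_k`.

Self-similarity. On each doubled triangle, `Δf = 1` at the three midpoints determines their values
from the corners. If moreover the corners carry `5g`, then `4Δf = 3·4Δg - 8` at the corners
(`IsRefinement.cellLaplacian_even`), and `4` is the fixed point of `t ↦ 3t - 8`. Hence `z ↦ f(2z)/5`
solves the problem whenever `f` does, which gives uniqueness by descent; the same formulas read as a
recursion give existence.

Verification. `ψ_k` is a rotation of the triangle `G_k`, so `Δu_k = 1` inside the ball away from the
origin. Rows `0` and `1` of `ũ` become the spheres of radius `2^k` and `2^k - 1`: outside the
cluster a vertex sees at most two neighbours of value at most `2`, so `Δu_k ≤ 1`. At the origin,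
`uTilde_apex` gives `Δu_k(o) = 1 - 3^(k+1)`, which is why the initial mass is `3^(k+1)`. -/

/-! ### Unit triangles and binary digits. -/

/-- `GasketCell a b` says that `a, b ≥ 0` have disjoint binary expansions, that is, that
`{(a, b), (a + 1, b), (a, b + 1)}` is one of the unit triangles of the gasket. -/
inductive GasketCell : ℤ → ℤ → Prop
  | origin : GasketCell 0 0
  | even {a b : ℤ} : GasketCell a b → GasketCell (2 * a) (2 * b)
  | right {a b : ℤ} : GasketCell a b → GasketCell (2 * a + 1) (2 * b)
  | up {a b : ℤ} : GasketCell a b → GasketCell (2 * a) (2 * b + 1)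

namespace GasketCell

theorem nonneg {a b : ℤ} (h : GasketCell a b) : 0 ≤ a ∧ 0 ≤ b := by
  induction h <;> omega

theorem exists_half {a b : ℤ} (h : GasketCell a b) : ∃ c d, GasketCell c d ∧
    ((a = 2 * c ∧ b = 2 * d) ∨ (a = 2 * c + 1 ∧ b = 2 * d) ∨ (a = 2 * c ∧ b = 2 * d + 1)) := by
  cases h with
  | origin => exact ⟨0, 0, origin, by simp⟩
  | even h => exact ⟨_, _, h, by simp⟩
  | right h => exact ⟨_, _, h, by simp⟩
  | up h => exact ⟨_, _, h, by simp⟩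

theorem even_iff {x y a b : ℤ} (hx : x = 2 * a) (hy : y = 2 * b) :
    GasketCell x y ↔ GasketCell a b := by
  subst hx hy
  refine ⟨fun h => ?_, even⟩
  obtain ⟨c, d, hc, h⟩ := h.exists_half
  obtain ⟨rfl, rfl⟩ : a = c ∧ b = d := by omega
  exact hc

theorem right_iff {x y a b : ℤ} (hx : x = 2 * a + 1) (hy : y = 2 * b) :
    GasketCell x y ↔ GasketCell a b := by
  subst hx hy
  refine ⟨fun h => ?_, right⟩
  obtain ⟨c, d, hc, h⟩ := h.exists_half
  obtain ⟨rfl, rfl⟩ : a = c ∧ b = d := by omega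
  exact hc

theorem up_iff {x y a b : ℤ} (hx : x = 2 * a) (hy : y = 2 * b + 1) :
    GasketCell x y ↔ GasketCell a b := by
  subst hx hy
  refine ⟨fun h => ?_, up⟩
  obtain ⟨c, d, hc, h⟩ := h.exists_half
  obtain ⟨rfl, rfl⟩ : a = c ∧ b = d := by omega
  exact hc

theorem not_odd_odd {x y a b : ℤ} (hx : x = 2 * a + 1) (hy : y = 2 * b + 1) :
    ¬ GasketCell x y := by
  intro h
  obtain ⟨c, d, hc, h⟩ := h.exists_half
  omega

/-- Since `a` and `b` have disjoint digits and `a + b + c` has `k` binary digits, all equal to `1`,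
the digits of `c` are those missing from `a` and `b`. So the digits of `a, b, c` partition the `k`
places, a condition symmetric in the three numbers. -/
theorem rotate {k : ℕ} : ∀ {a b c : ℤ}, GasketCell a b → 0 ≤ c → a + b + c + 1 = 2 ^ k →
    GasketCell b c := by
  induction k with
  | zero =>
    intro a b c h hc hs
    have := h.nonneg
    rw [pow_zero] at hs
    obtain ⟨rfl, rfl⟩ : b = 0 ∧ c = 0 := by omega
    exact origin
  | succ k ih =>
    intro a b c h hc hs
    rw [pow_succ] at hs
    obtain ⟨a', b', h', h⟩ := h.exists_half
    rcases h with ⟨rfl, rfl⟩ | ⟨rfl, rfl⟩ | ⟨rfl, rfl⟩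
    · exact (up_iff rfl (by omega)).2 (ih (c := c / 2) h' (by omega) (by omega))
    · exact (even_iff rfl (by omega)).2 (ih (c := c / 2) h' (by omega) (by omega))
    · exact (right_iff rfl (by omega)).2 (ih (c := c / 2) h' (by omega) (by omega))

theorem rotate_iff {k : ℕ} {a b c : ℤ} (ha : 0 ≤ a) (hb : 0 ≤ b) (hc : 0 ≤ c)
    (h : a + b + c + 1 = 2 ^ k) : GasketCell a b ↔ GasketCell b c :=
  ⟨fun h' => h'.rotate hc h,
    fun h' => (h'.rotate ha (by linarith)).rotate hb (by linarith)⟩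

theorem zero_right {a : ℤ} (ha : 0 ≤ a) : GasketCell a 0 := by
  induction n : a.toNat using Nat.strong_induction_on generalizing a with
  | _ n ih =>
    subst n
    rcases Int.even_or_odd' a with ⟨c, rfl | rfl⟩
    · rcases ha.eq_or_lt with h | h
      · rw [← h]; exact origin
      · exact even (b := 0) (ih c.toNat (by omega) (by omega) rfl)
    · exact right (b := 0) (ih c.toNat (by omega) (by omega) rfl)

theorem zero_left {b : ℤ} (hb : 0 ≤ b) : GasketCell 0 b := by
  induction n : b.toNat using Nat.strong_induction_on generalizing b with
  | _ n ih =>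
    subst n
    rcases Int.even_or_odd' b with ⟨c, rfl | rfl⟩
    · rcases hb.eq_or_lt with h | h
      · rw [← h]; exact origin
      · exact even (a := 0) (ih c.toNat (by omega) (by omega) rfl)
    · exact up (a := 0) (ih c.toNat (by omega) (by omega) rfl)

/-- The cells of `G_{k+1}` are the cells of the three translates of `G_k`. -/
theorem lt_two_pow_succ_iff (k : ℕ) : ∀ a b : ℤ, (GasketCell a b ∧ a + b < 2 ^ (k + 1)) ↔
    (GasketCell a b ∧ a + b < 2 ^ k) ∨ (GasketCell (a - 2 ^ k) b ∧ a - 2 ^ k + b < 2 ^ k) ∨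
      (GasketCell a (b - 2 ^ k) ∧ a + (b - 2 ^ k) < 2 ^ k) := by
  induction k with
  | zero =>
    intro a b
    simp only [zero_add, pow_one, pow_zero]
    constructor
    · rintro ⟨h, h2⟩
      have := h.nonneg
      obtain ⟨rfl, rfl⟩ | ⟨rfl, rfl⟩ | ⟨rfl, rfl⟩ :
        (a = 0 ∧ b = 0) ∨ (a = 1 ∧ b = 0) ∨ (a = 0 ∧ b = 1) := by omega
      · exact Or.inl ⟨h, by simp⟩
      · exact Or.inr (Or.inl ⟨origin, by simp⟩)
      · exact Or.inr (Or.inr ⟨origin, by simp⟩)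
    · rintro (⟨h, h2⟩ | ⟨h, h2⟩ | ⟨h, h2⟩) <;> have := h.nonneg
      · exact ⟨h, by omega⟩
      · obtain ⟨rfl, rfl⟩ : a = 1 ∧ b = 0 := by omega
        exact ⟨zero_right zero_le_one, by simp⟩
      · obtain ⟨rfl, rfl⟩ : a = 0 ∧ b = 1 := by omega
        exact ⟨zero_left zero_le_one, by simp⟩
  | succ k ih =>
    intro a b
    obtain ⟨c, hc⟩ := Int.even_or_odd' a
    obtain ⟨d, hd⟩ := Int.even_or_odd' b
    have hk : (2 : ℤ) ^ (k + 1) = 2 * 2 ^ k := pow_succ' 2 k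
    have hk2 : (2 : ℤ) ^ (k + 1 + 1) = 2 * 2 ^ (k + 1) := pow_succ' 2 (k + 1)
    have key := ih c d
    -- The shift `2^(k+1)` is even, so it preserves parities and each parity class reduces to the
    -- statement for the halves.
    rcases hc with hc | hc <;> rcases hd with hd | hd
    · rw [even_iff hc hd, even_iff (a := c - 2 ^ k) (by omega) hd,
        even_iff hc (b := d - 2 ^ k) (by omega)]
      rwa [show a + b < 2 ^ (k + 1 + 1) ↔ c + d < 2 ^ (k + 1) by omega,
        show a + b < 2 ^ (k + 1) ↔ c + d < 2 ^ k by omega,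
        show a - 2 ^ (k + 1) + b < 2 ^ (k + 1) ↔ c - 2 ^ k + d < 2 ^ k by omega,
        show a + (b - 2 ^ (k + 1)) < 2 ^ (k + 1) ↔ c + (d - 2 ^ k) < 2 ^ k by omega]
    · rw [up_iff hc hd, up_iff (a := c - 2 ^ k) (by omega) hd,
        up_iff hc (b := d - 2 ^ k) (by omega)]
      rwa [show a + b < 2 ^ (k + 1 + 1) ↔ c + d < 2 ^ (k + 1) by omega,
        show a + b < 2 ^ (k + 1) ↔ c + d < 2 ^ k by omega,
        show a - 2 ^ (k + 1) + b < 2 ^ (k + 1) ↔ c - 2 ^ k + d < 2 ^ k by omega,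
        show a + (b - 2 ^ (k + 1)) < 2 ^ (k + 1) ↔ c + (d - 2 ^ k) < 2 ^ k by omega]
    · rw [right_iff hc hd, right_iff (a := c - 2 ^ k) (by omega) hd,
        right_iff hc (b := d - 2 ^ k) (by omega)]
      rwa [show a + b < 2 ^ (k + 1 + 1) ↔ c + d < 2 ^ (k + 1) by omega,
        show a + b < 2 ^ (k + 1) ↔ c + d < 2 ^ k by omega,
        show a - 2 ^ (k + 1) + b < 2 ^ (k + 1) ↔ c - 2 ^ k + d < 2 ^ k by omega,
        show a + (b - 2 ^ (k + 1)) < 2 ^ (k + 1) ↔ c + (d - 2 ^ k) < 2 ^ k by omega]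
    · simp only [not_odd_odd hc hd, not_odd_odd (a := c - 2 ^ k) (x := a - 2 ^ (k + 1))
        (by omega) hd, not_odd_odd hc (b := d - 2 ^ k) (y := b - 2 ^ (k + 1)) (by omega),
        false_and, or_self]

end GasketCell

/-! ### The finite graphs `G_k` in terms of unit triangles. -/

/-- The three corners of the unit triangle with lower left corner `(a, b)`. -/
def IsGasketCorner (a b : ℤ) (z : ℤ × ℤ) : Prop := z = (a, b) ∨ z = (a + 1, b) ∨ z = (a, b + 1)

theorem isGasketCorner_sub_iff {a b : ℤ} {z w : ℤ × ℤ} :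
    IsGasketCorner a b (z - w) ↔ IsGasketCorner (a + w.1) (b + w.2) z := by
  obtain ⟨x, y⟩ := z
  obtain ⟨s, t⟩ := w
  simp only [IsGasketCorner, Prod.mk_sub_mk, Prod.mk.injEq]
  omega

/-- The predicate is left arbitrary so that the same induction step serves both vertices and edges.
-/
theorem exists_cell_succ_iff (k : ℕ) (P : ℤ → ℤ → Prop) :
    (∃ a b, GasketCell a b ∧ a + b < 2 ^ (k + 1) ∧ P a b) ↔
      ∃ i : Fin 3, ∃ a b, GasketCell a b ∧ a + b < 2 ^ k ∧
        P (a + (gasketShift k i).1) (b + (gasketShift k i).2) := by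
  simp only [Fin.exists_fin_succ, gasketShift]
  simp only [← and_assoc, GasketCell.lt_two_pow_succ_iff]
  constructor
  · rintro ⟨a, b, h | h | h, hP⟩
    · exact Or.inl ⟨a, b, h, by simpa using hP⟩
    · exact Or.inr (Or.inl ⟨a - 2 ^ k, b, h, by simpa using hP⟩)
    · exact Or.inr (Or.inr (Or.inl ⟨a, b - 2 ^ k, h, by simpa using hP⟩))
  · rintro (⟨a, b, h, hP⟩ | ⟨a, b, h, hP⟩ | ⟨a, b, h, hP⟩ | ⟨i, -⟩)
    · exact ⟨a, b, Or.inl h, by simpa using hP⟩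
    · exact ⟨a + 2 ^ k, b, Or.inr (Or.inl (by simpa using h)), by simpa using hP⟩
    · exact ⟨a, b + 2 ^ k, Or.inr (Or.inr (by simpa using h)), by simpa using hP⟩
    · exact i.elim0

theorem mem_gasketLevelVertices_iff (k : ℕ) : ∀ z : ℤ × ℤ, z ∈ gasketLevelVertices k ↔
    ∃ a b, GasketCell a b ∧ a + b < 2 ^ k ∧ IsGasketCorner a b z := by
  induction k with
  | zero =>
    intro z
    simp only [gasketLevelVertices, Set.mem_insert_iff, Set.mem_singleton_iff]
    constructor
    · exact fun h => ⟨0, 0, .origin, by simp, h⟩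
    · rintro ⟨a, b, h, hs, hz⟩
      have := h.nonneg
      obtain ⟨rfl, rfl⟩ : a = 0 ∧ b = 0 := by rw [pow_zero] at hs; omega
      exact hz
  | succ k ih =>
    intro z
    rw [exists_cell_succ_iff k (fun a b => IsGasketCorner a b z)]
    simp only [gasketLevelVertices, Set.mem_iUnion, ← isGasketCorner_sub_iff, ← ih]
    refine exists_congr fun i => ⟨?_, fun h => ⟨_, h, by simp⟩⟩
    rintro ⟨w, hw, rfl⟩
    simpa using hw

theorem gasketLevel_adj_iff (k : ℕ) : ∀ u v : ℤ × ℤ, (gasketLevel k).Adj u v ↔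
    ∃ a b, GasketCell a b ∧ a + b < 2 ^ k ∧ IsGasketCorner a b u ∧ IsGasketCorner a b v ∧ u ≠ v := by
  induction k with
  | zero =>
    intro u v
    change (u ∈ gasketLevelVertices 0 ∧ v ∈ gasketLevelVertices 0 ∧ u ≠ v) ↔ _
    simp only [gasketLevelVertices, Set.mem_insert_iff, Set.mem_singleton_iff]
    constructor
    · exact fun h => ⟨0, 0, .origin, by simp, h⟩
    · rintro ⟨a, b, h, hs, hz⟩
      have := h.nonneg
      obtain ⟨rfl, rfl⟩ : a = 0 ∧ b = 0 := by rw [pow_zero] at hs; omega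
      exact hz
  | succ k ih =>
    intro u v
    rw [exists_cell_succ_iff k (fun a b => IsGasketCorner a b u ∧ IsGasketCorner a b v ∧ u ≠ v)]
    simp only [gasketLevel, SimpleGraph.iSup_adj, SimpleGraph.map_adj, ← isGasketCorner_sub_iff]
    refine exists_congr fun i => ?_
    constructor
    · rintro ⟨a, b, hab, rfl, rfl⟩
      simpa using (ih a b).1 hab
    · intro h
      refine ⟨u - gasketShift k i, v - gasketShift k i, (ih _ _).2 ?_, by simp, by simp⟩
      simpa using h

theorem exists_lt_two_pow (n : ℤ) : ∃ k : ℕ, n < 2 ^ k := by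
  obtain ⟨k, hk⟩ := pow_unbounded_of_one_lt n (one_lt_two : (1 : ℤ) < 2)
  exact ⟨k, hk⟩

theorem exists_gasketLevel_adj_iff (u v : ℤ × ℤ) : (∃ k, (gasketLevel k).Adj u v) ↔
    ∃ a b, GasketCell a b ∧ IsGasketCorner a b u ∧ IsGasketCorner a b v ∧ u ≠ v := by
  simp only [gasketLevel_adj_iff]
  constructor
  · rintro ⟨k, a, b, h, -, h'⟩
    exact ⟨a, b, h, h'⟩
  · rintro ⟨a, b, h, h'⟩
    obtain ⟨k, hk⟩ := exists_lt_two_pow (a + b)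
    exact ⟨k, a, b, h, hk, h'⟩

/-! ### Vertices of the one-sided gasket. -/

/-- `(x, y)` is a corner of some unit triangle of the gasket. -/
def GasketVertex (x y : ℤ) : Prop := GasketCell x y ∨ GasketCell (x - 1) y ∨ GasketCell x (y - 1)

theorem mem_gasketPlus_iff (x y : ℤ) : (x, y) ∈ gasketPlus ↔ GasketVertex x y := by
  simp only [gasketPlus, Set.mem_iUnion, mem_gasketLevelVertices_iff, IsGasketCorner, Prod.mk.injEq]
  constructor
  · rintro ⟨k, a, b, h, -, ⟨rfl, rfl⟩ | ⟨rfl, rfl⟩ | ⟨rfl, rfl⟩⟩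
    · exact Or.inl h
    · exact Or.inr (Or.inl (by simpa using h))
    · exact Or.inr (Or.inr (by simpa using h))
  · obtain ⟨k, hk⟩ := exists_lt_two_pow (x + y)
    rintro (h | h | h)
    · exact ⟨k, _, _, h, by omega, by simp⟩
    · exact ⟨k, _, _, h, by omega, by simp⟩
    · exact ⟨k, _, _, h, by omega, by simp⟩

theorem GasketVertex.nonneg {x y : ℤ} (h : GasketVertex x y) : 0 ≤ x ∧ 0 ≤ y := by
  rcases h with h | h | h <;> have := h.nonneg <;> omega

/-- Self-similarity under doubling: a vertex is either twice a vertex or the midpoint of a side of a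
doubled triangle. The later inductions on `x + y` descend along this dichotomy. -/
theorem GasketVertex.cases_half {x y : ℤ} (h : GasketVertex x y) : ∃ a b,
    (GasketVertex a b ∧ x = 2 * a ∧ y = 2 * b) ∨
    GasketCell a b ∧ ((x = 2 * a + 1 ∧ y = 2 * b) ∨ (x = 2 * a ∧ y = 2 * b + 1) ∨
      (x = 2 * a + 1 ∧ y = 2 * b + 1)) := by
  obtain ⟨a, ha⟩ := Int.even_or_odd' x
  obtain ⟨b, hb⟩ := Int.even_or_odd' y
  refine ⟨a, b, ?_⟩
  unfold GasketVertex at *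
  rcases ha with ha | ha <;> rcases hb with hb | hb
  · left
    rw [GasketCell.even_iff ha hb, GasketCell.right_iff (a := a - 1) (by omega) hb,
      GasketCell.up_iff (b := b - 1) ha (by omega)] at h
    exact ⟨h, ha, hb⟩
  · right
    rw [GasketCell.up_iff ha hb, GasketCell.even_iff ha (b := b) (by omega)] at h
    have := GasketCell.not_odd_odd (x := x - 1) (a := a - 1) (by omega) hb
    exact ⟨by tauto, by tauto⟩
  · right
    rw [GasketCell.right_iff ha hb, GasketCell.even_iff (a := a) (by omega) hb] at h
    have := GasketCell.not_odd_odd ha (y := y - 1) (b := b - 1) (by omega)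
    exact ⟨by tauto, by tauto⟩
  · right
    rw [GasketCell.up_iff (x := x - 1) (a := a) (by omega) hb,
        GasketCell.right_iff ha (y := y - 1) (b := b) (by omega)] at h
    have := GasketCell.not_odd_odd ha hb
    exact ⟨by tauto, by tauto⟩

/-- A vertex of `SG⁺` other than the origin lies in exactly two unit triangles. -/
theorem GasketVertex.two_cells {x y : ℤ} (h : GasketVertex x y) (h0 : 0 < x + y) :
    (GasketCell x y ∧ GasketCell (x - 1) y ∧ ¬ GasketCell x (y - 1)) ∨
    (GasketCell x y ∧ ¬ GasketCell (x - 1) y ∧ GasketCell x (y - 1)) ∨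
    (¬ GasketCell x y ∧ GasketCell (x - 1) y ∧ GasketCell x (y - 1)) := by
  induction n : x.toNat + y.toNat using Nat.strong_induction_on generalizing x y with
  | _ n ih =>
    have hn := h.nonneg
    obtain ⟨a, b, ⟨h', ha, hb⟩ | ⟨h', ⟨ha, hb⟩ | ⟨ha, hb⟩ | ⟨ha, hb⟩⟩⟩ := h.cases_half
    · rw [GasketCell.even_iff ha hb, GasketCell.right_iff (a := a - 1) (by omega) hb,
        GasketCell.up_iff (b := b - 1) ha (by omega)]
      exact ih _ (by omega) h' (by omega) rfl
    · rw [GasketCell.right_iff ha hb, GasketCell.even_iff (a := a) (by omega) hb]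
      have := GasketCell.not_odd_odd ha (y := y - 1) (b := b - 1) (by omega)
      tauto
    · rw [GasketCell.up_iff ha hb, GasketCell.even_iff ha (b := b) (by omega)]
      have := GasketCell.not_odd_odd (x := x - 1) (a := a - 1) (by omega) hb
      tauto
    · rw [GasketCell.up_iff (x := x - 1) (a := a) (by omega) hb,
        GasketCell.right_iff ha (y := y - 1) (b := b) (by omega)]
      have := GasketCell.not_odd_odd ha hb
      tauto

theorem GasketVertex.rotate {k : ℕ} {x y : ℤ} (h : GasketVertex x y) (hk : x + y ≤ 2 ^ k) :
    GasketVertex y (2 ^ k - x - y) := by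
  have hn := h.nonneg
  have hp : (0 : ℤ) < 2 ^ k := by positivity
  rcases hn.1.eq_or_lt with h1 | h1
  -- In all remaining cases the rotated triangle is one with corner sum `x + y - 1`. The triangle at
  -- `(x, y)` itself would leave the ball when `x + y = 2^k`.
  · rcases hn.2.eq_or_lt with h2 | h2
    · exact Or.inl (by rw [← h2]; exact GasketCell.zero_left (by omega))
    rcases h.two_cells (by omega) with ⟨h, h', -⟩ | ⟨h, -, h'⟩ | ⟨-, h, h'⟩
    all_goals first
      | (have := h'.nonneg; exact Or.inr (Or.inl (h'.rotate (k := k) (by omega) (by omega))))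
      | (have := h'.nonneg; omega)
  · rcases h.two_cells (by omega) with ⟨-, h, -⟩ | ⟨-, -, h⟩ | ⟨-, h, -⟩
    · exact Or.inl (h.rotate (k := k) (by omega) (by omega))
    · exact Or.inr (Or.inl (h.rotate (k := k) (by omega) (by omega)))
    · exact Or.inl (h.rotate (k := k) (by omega) (by omega))

/-! ### Neighbourhoods and the Laplacian of the double-sided gasket. -/

theorem gasketGraph_adj_iff (u v : Gasket) : gasketGraph.Adj u v ↔
    (∃ a b, GasketCell a b ∧ IsGasketCorner a b u ∧ IsGasketCorner a b v ∧ (u : ℤ × ℤ) ≠ v) ∨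
    (∃ a b, GasketCell a b ∧ IsGasketCorner a b (-u) ∧ IsGasketCorner a b (-v) ∧
      -(u : ℤ × ℤ) ≠ -v) := by
  rw [← exists_gasketLevel_adj_iff, ← exists_gasketLevel_adj_iff]
  rfl

theorem gasketSet_iff (x y : ℤ) :
    (x, y) ∈ gasketSet ↔ GasketVertex x y ∨ GasketVertex (-x) (-y) := by
  rw [← mem_gasketPlus_iff, ← mem_gasketPlus_iff]
  rfl

theorem GasketVertex.of_isGasketCorner {a b : ℤ} {z : ℤ × ℤ} (h : GasketCell a b)
    (hz : IsGasketCorner a b z) : GasketVertex z.1 z.2 := by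
  rcases hz with rfl | rfl | rfl
  · exact Or.inl h
  · exact Or.inr (Or.inl (by simpa using h))
  · exact Or.inr (Or.inr (by simpa using h))

open Classical in
/-- The neighbours of `(x, y)` in the one-sided gasket. -/
noncomputable def gasketPlusNeighbors (x y : ℤ) : Finset (ℤ × ℤ) :=
  ((if GasketCell x y then {(x + 1, y), (x, y + 1)} else ∅) ∪
    (if GasketCell (x - 1) y then {(x - 1, y), (x - 1, y + 1)} else ∅)) ∪
    (if GasketCell x (y - 1) then {(x, y - 1), (x + 1, y - 1)} else ∅)

theorem mem_gasketPlusNeighbors_iff (u v : ℤ × ℤ) : v ∈ gasketPlusNeighbors u.1 u.2 ↔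
    ∃ a b, GasketCell a b ∧ IsGasketCorner a b u ∧ IsGasketCorner a b v ∧ u ≠ v := by
  obtain ⟨x, y⟩ := u
  obtain ⟨s, t⟩ := v
  simp only [gasketPlusNeighbors, Finset.mem_union, IsGasketCorner, Prod.mk.injEq, ne_eq]
  constructor
  · rintro ((h | h) | h)
    · split_ifs at h with hc
      · refine ⟨x, y, hc, ?_⟩
        simp only [Finset.mem_insert, Finset.mem_singleton, Prod.mk.injEq] at h
        omega
      · simp at h
    · split_ifs at h with hc
      · refine ⟨x - 1, y, hc, ?_⟩
        simp only [Finset.mem_insert, Finset.mem_singleton, Prod.mk.injEq] at h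
        omega
      · simp at h
    · split_ifs at h with hc
      · refine ⟨x, y - 1, hc, ?_⟩
        simp only [Finset.mem_insert, Finset.mem_singleton, Prod.mk.injEq] at h
        omega
      · simp at h
  · rintro ⟨a, b, hc, ⟨rfl, rfl⟩ | ⟨rfl, rfl⟩ | ⟨rfl, rfl⟩, h, hne⟩
    · left; left
      rw [if_pos hc]
      simp only [Finset.mem_insert, Finset.mem_singleton, Prod.mk.injEq]
      omega
    · left; right
      rw [if_pos (by simpa using hc)]
      simp only [Finset.mem_insert, Finset.mem_singleton, Prod.mk.injEq]
      omega
    · right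
      rw [if_pos (by simpa using hc)]
      simp only [Finset.mem_insert, Finset.mem_singleton, Prod.mk.injEq]
      omega

open Classical in
/-- Four times the Laplacian of `f` at a vertex `(x, y)` of `SG⁺` other than the origin, as a sum
over the unit triangles that contain the vertex. -/
noncomputable def cellLaplacian (f : ℤ × ℤ → ℝ) (x y : ℤ) : ℝ :=
  (if GasketCell x y then f (x + 1, y) + f (x, y + 1) - 2 * f (x, y) else 0) +
    (if GasketCell (x - 1) y then f (x - 1, y) + f (x - 1, y + 1) - 2 * f (x, y) else 0) +
    (if GasketCell x (y - 1) then f (x, y - 1) + f (x + 1, y - 1) - 2 * f (x, y) else 0)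

theorem sum_gasketPlusNeighbors (f : ℤ × ℤ → ℝ) {x y : ℤ} (h : GasketVertex x y)
    (h0 : 0 < x + y) :
    ∑ w ∈ gasketPlusNeighbors x y, f w = cellLaplacian f x y + 4 * f (x, y) := by
  unfold gasketPlusNeighbors cellLaplacian
  rw [Finset.sum_union, Finset.sum_union]
  · rcases h.two_cells h0 with ⟨h1, h2, h3⟩ | ⟨h1, h2, h3⟩ | ⟨h1, h2, h3⟩ <;>
    · simp only [h1, h2, h3, if_true, if_false, Finset.sum_empty]
      repeat rw [Finset.sum_pair (by simp)]
      ring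
  · rw [Finset.disjoint_left]
    intro a ha hb
    split_ifs at ha hb <;> simp only [Finset.mem_insert, Finset.mem_singleton, Finset.notMem_empty,
      Prod.ext_iff] at ha hb
    omega
  · rw [Finset.disjoint_left]
    intro a ha hb
    split_ifs at ha hb <;> simp only [Finset.mem_insert, Finset.mem_singleton, Finset.notMem_empty,
      Prod.ext_iff, Finset.mem_union, or_false, false_or] at ha hb <;>
    omega

theorem sum_neighborFinset_eq (f : ℤ × ℤ → ℝ) (z : Gasket) (s : Finset (ℤ × ℤ))
    (hs : ∀ w : ℤ × ℤ, w ∈ s ↔ ∃ h : w ∈ gasketSet, gasketGraph.Adj z ⟨w, h⟩) :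
    ∑ w ∈ gasketGraph.neighborFinset z, f w = ∑ w ∈ s, f w := by
  have : s = (gasketGraph.neighborFinset z).map (Function.Embedding.subtype _) := by
    ext w
    simp [hs]
  rw [this, Finset.sum_map]
  rfl

theorem gasketLaplacian_of_plus (f : ℤ × ℤ → ℝ) (z : Gasket) {x y : ℤ} (hz : (z : ℤ × ℤ) = (x, y))
    (h : GasketVertex x y) (h0 : 0 < x + y) :
    gasketLaplacian (fun w => f w) z = cellLaplacian f x y / 4 := by
  unfold gasketLaplacian
  rw [sum_neighborFinset_eq f z (gasketPlusNeighbors x y), sum_gasketPlusNeighbors f h h0]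
  · beta_reduce
    rw [hz]
    ring
  · intro w
    have key := mem_gasketPlusNeighbors_iff (x, y) w
    rw [key]
    constructor
    · rintro ⟨a, b, hc, h1, h2, h3⟩
      refine ⟨Or.inl ((mem_gasketPlus_iff _ _).2 (.of_isGasketCorner hc h2)), ?_⟩
      rw [gasketGraph_adj_iff, hz]
      exact Or.inl ⟨a, b, hc, h1, h2, h3⟩
    · rintro ⟨hw, hadj⟩
      rw [gasketGraph_adj_iff, hz] at hadj
      -- No mirrored triangle contains a vertex of `SG⁺` other than the origin, by the signs of the
      -- coordinates.
      rcases hadj with hadj | ⟨a, b, hc, h1, -⟩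
      · exact hadj
      · have := (GasketVertex.of_isGasketCorner hc h1).nonneg
        have := h.nonneg
        simp only [Prod.neg_mk] at *
        omega

/-- The point reflection of the gasket in the origin. -/
def gasketNeg : Gasket ≃ Gasket where
  toFun z := ⟨-z, by simpa [gasketSet, or_comm] using z.2⟩
  invFun z := ⟨-z, by simpa [gasketSet, or_comm] using z.2⟩
  left_inv z := by simp
  right_inv z := by simp

@[simp]
theorem coe_gasketNeg (z : Gasket) : (gasketNeg z : ℤ × ℤ) = -z := rfl

theorem gasketNeg_adj_iff (u v : Gasket) :
    gasketGraph.Adj (gasketNeg u) (gasketNeg v) ↔ gasketGraph.Adj u v := by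
  simp only [gasketGraph_adj_iff, coe_gasketNeg, neg_neg]
  exact or_comm

theorem gasketLaplacian_gasketNeg (f : Gasket → ℝ) (z : Gasket) :
    gasketLaplacian f (gasketNeg z) = gasketLaplacian (fun w => f (gasketNeg w)) z := by
  unfold gasketLaplacian
  congr 2
  symm
  refine Finset.sum_equiv gasketNeg (fun w => ?_) (fun _ _ => rfl)
  simp only [SimpleGraph.mem_neighborFinset]
  exact (gasketNeg_adj_iff z w).symm

theorem gasketLaplacian_origin (f : ℤ × ℤ → ℝ) :
    gasketLaplacian (fun w => f w) gasketOrigin =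
      (f (1, 0) + f (0, 1) + f (-1, 0) + f (0, -1)) / 4 - f (0, 0) := by
  unfold gasketLaplacian
  rw [sum_neighborFinset_eq f gasketOrigin {(1, 0), (0, 1), (-1, 0), (0, -1)}]
  · rw [Finset.sum_insert (by decide), Finset.sum_insert (by decide), Finset.sum_pair (by decide)]
    simp only [gasketOrigin]
    ring
  · rintro ⟨s, t⟩
    simp only [Finset.mem_insert, Finset.mem_singleton, gasketGraph_adj_iff, gasketOrigin,
      IsGasketCorner, Prod.neg_mk, Prod.mk.injEq, ne_eq]
    constructor
    · intro h
      have h1 : GasketVertex 1 0 := Or.inl (.zero_right zero_le_one)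
      have h2 : GasketVertex 0 1 := Or.inl (.zero_left zero_le_one)
      refine ⟨?_, ?_⟩
      · rw [gasketSet_iff]
        rcases h with ⟨rfl, rfl⟩ | ⟨rfl, rfl⟩ | ⟨rfl, rfl⟩ | ⟨rfl, rfl⟩ <;> simp [h1, h2]
      · have h3 : (s = 1 ∧ t = 0 ∨ s = 0 ∧ t = 1) ∨ (s = -1 ∧ t = 0 ∨ s = 0 ∧ t = -1) := by omega
        refine h3.imp (fun h => ⟨0, 0, .origin, ?_⟩) (fun h => ⟨0, 0, .origin, ?_⟩) <;> omega
    · rintro ⟨-, ⟨a, b, hc, h⟩ | ⟨a, b, hc, h⟩⟩ <;> have := hc.nonneg <;> omega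

/-- Together with the reflection symmetry this reduces local statements to the origin and to `SG⁺`
without the origin. -/
theorem Gasket.cases (z : Gasket) : z = gasketOrigin ∨
    ∃ x y : ℤ, GasketVertex x y ∧ 0 < x + y ∧
      ((z : ℤ × ℤ) = (x, y) ∨ ∃ w : Gasket, (w : ℤ × ℤ) = (x, y) ∧ z = gasketNeg w) := by
  obtain ⟨⟨x, y⟩, hz⟩ := z
  by_cases h0 : x = 0 ∧ y = 0
  · left
    obtain ⟨rfl, rfl⟩ := h0
    rfl
  right
  rcases (gasketSet_iff x y).1 hz with h | h <;> have := h.nonneg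
  · exact ⟨x, y, h, by omega, Or.inl rfl⟩
  · refine ⟨-x, -y, h, by omega, Or.inr ⟨⟨(-x, -y), (gasketSet_iff _ _).2 (Or.inl h)⟩, rfl, ?_⟩⟩
    simp [gasketNeg]

/-! ### Balls in the graph metric. -/

/-- The graph norm of a vertex of the gasket. -/
def gasketNorm (z : ℤ × ℤ) : ℕ := z.1.natAbs + z.2.natAbs

theorem gasketNorm_neg (z : ℤ × ℤ) : gasketNorm (-z) = gasketNorm z := by
  simp [gasketNorm]

theorem gasketNorm_le_of_adj {u v : Gasket} (h : gasketGraph.Adj u v) :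
    gasketNorm v ≤ gasketNorm u + 1 := by
  rw [gasketGraph_adj_iff] at h
  rcases h with ⟨a, b, hc, hu, hv, -⟩ | ⟨a, b, hc, hu, hv, -⟩
  · have := hc.nonneg
    rcases hu with hu | hu | hu <;> rcases hv with hv | hv | hv <;> rw [hu, hv] <;>
      simp only [gasketNorm] <;> omega
  · have := hc.nonneg
    rw [← gasketNorm_neg u, ← gasketNorm_neg v]
    rcases hu with hu | hu | hu <;> rcases hv with hv | hv | hv <;> rw [hu, hv] <;>
      simp only [gasketNorm] <;> omega

/-- Of the two triangles at the vertex, at least one has it as a right or upper corner; the lower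
left corner of that triangle is one step closer to the origin. -/
theorem exists_adj_gasketNorm_lt_of_plus (z : Gasket) {x y : ℤ} (hz : (z : ℤ × ℤ) = (x, y))
    (h : GasketVertex x y) (h0 : 0 < x + y) :
    ∃ w, gasketGraph.Adj w z ∧ gasketNorm w + 1 = gasketNorm z := by
  have key : ∀ s t : ℤ, GasketCell s t → IsGasketCorner s t (x, y) → s + t + 1 = x + y →
      ∃ w, gasketGraph.Adj w z ∧ gasketNorm w + 1 = gasketNorm z := by
    intro s t hc hs hst
    refine ⟨⟨(s, t), (gasketSet_iff _ _).2 (Or.inl (Or.inl hc))⟩, ?_, ?_⟩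
    · rw [gasketGraph_adj_iff, hz]
      refine Or.inl ⟨s, t, hc, Or.inl rfl, hs, ?_⟩
      simp only [ne_eq, Prod.mk.injEq]
      omega
    · have := hc.nonneg
      have := h.nonneg
      simp only [hz, gasketNorm]
      omega
  rcases h.two_cells h0 with ⟨-, h, -⟩ | ⟨-, -, h⟩ | ⟨-, h, -⟩
  · exact key _ _ h (by simp [IsGasketCorner]) (by ring)
  · exact key _ _ h (by simp [IsGasketCorner]) (by ring)
  · exact key _ _ h (by simp [IsGasketCorner]) (by ring)

theorem exists_adj_gasketNorm_lt (z : Gasket) (hz : z ≠ gasketOrigin) :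
    ∃ w, gasketGraph.Adj w z ∧ gasketNorm w + 1 = gasketNorm z := by
  rcases z.cases with h | ⟨x, y, h, h0, hz | ⟨w, hw, rfl⟩⟩
  · exact absurd h hz
  · exact exists_adj_gasketNorm_lt_of_plus z hz h h0
  · obtain ⟨v, hv, hn⟩ := exists_adj_gasketNorm_lt_of_plus w hw h h0
    refine ⟨gasketNeg v, (gasketNeg_adj_iff v w).2 hv, ?_⟩
    simpa [gasketNorm_neg] using hn

theorem mem_gasketBall_iff (n : ℕ) (z : Gasket) : z ∈ gasketBall n ↔ gasketNorm z ≤ n := by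
  constructor
  · intro h
    change gasketGraph.edist gasketOrigin z ≤ n at h
    obtain ⟨p, hp⟩ := SimpleGraph.exists_walk_of_edist_ne_top
      (ne_top_of_le_ne_top (ENat.natCast_ne_top n) h)
    have hlen : ∀ {u v : Gasket} (p : gasketGraph.Walk u v),
        gasketNorm v ≤ gasketNorm u + p.length := by
      intro u v p
      induction p with
      | nil => simp
      | cons h p ih =>
        have := gasketNorm_le_of_adj h
        rw [SimpleGraph.Walk.length_cons]
        omega
    have h1 := hlen p
    rw [← hp, Nat.cast_le] at h
    have h2 : gasketNorm gasketOrigin = 0 := rfl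
    omega
  · intro h
    refine le_trans ?_ (Nat.cast_le (α := ℕ∞).2 h)
    clear h
    obtain ⟨m, hm⟩ : ∃ m, gasketNorm z = m := ⟨_, rfl⟩
    rw [hm]
    induction m generalizing z with
    | zero =>
      have : z = gasketOrigin := by
        refine Subtype.ext (Prod.ext ?_ ?_) <;> simp only [gasketNorm, gasketOrigin] at * <;> omega
      simp [this]
    | succ m ih =>
      obtain ⟨w, hw, hn⟩ := exists_adj_gasketNorm_lt z
        (by rintro rfl; simp [gasketNorm, gasketOrigin] at hm)
      calc gasketGraph.edist gasketOrigin z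
          ≤ gasketGraph.edist gasketOrigin w + gasketGraph.edist w z :=
            SimpleGraph.edist_triangle
        _ ≤ m + 1 := add_le_add (ih w (by omega)) (SimpleGraph.edist_eq_one_iff_adj.2 hw).le
        _ = ((m + 1 : ℕ) : ℕ∞) := by simp

/-- At least one of the two triangles has its lower left corner in the column of the vertex, and its
right corner lies one column further out. This escape to infinity replaces connectedness in the
maximum principle. -/
theorem exists_adj_natAbs_lt_of_plus (z : Gasket) {x y : ℤ} (hz : (z : ℤ × ℤ) = (x, y))
    (h : GasketVertex x y) (h0 : 0 < x + y) :
    ∃ w, gasketGraph.Adj z w ∧ (z : ℤ × ℤ).1.natAbs < (w : ℤ × ℤ).1.natAbs := by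
  have key : ∀ s t : ℤ, GasketCell s t → IsGasketCorner s t (x, y) → s = x →
      ∃ w, gasketGraph.Adj z w ∧ (z : ℤ × ℤ).1.natAbs < (w : ℤ × ℤ).1.natAbs := by
    intro s t hc hs hst
    refine ⟨⟨(s + 1, t), (gasketSet_iff _ _).2 (Or.inl (Or.inr (Or.inl (by simpa using hc))))⟩,
      ?_, ?_⟩
    · rw [gasketGraph_adj_iff, hz]
      refine Or.inl ⟨s, t, hc, hs, Or.inr (Or.inl rfl), ?_⟩
      simp only [ne_eq, Prod.mk.injEq]
      omega
    · have := hc.nonneg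
      simp only [hz]
      omega
  rcases h.two_cells h0 with ⟨h, -, -⟩ | ⟨h, -, -⟩ | ⟨-, -, h⟩
  · exact key _ _ h (by simp [IsGasketCorner]) rfl
  · exact key _ _ h (by simp [IsGasketCorner]) rfl
  · exact key _ _ h (by simp [IsGasketCorner]) rfl

theorem exists_adj_natAbs_lt (z : Gasket) :
    ∃ w, gasketGraph.Adj z w ∧ (z : ℤ × ℤ).1.natAbs < (w : ℤ × ℤ).1.natAbs := by
  rcases z.cases with rfl | ⟨x, y, h, h0, hz | ⟨w, hw, rfl⟩⟩
  · refine ⟨⟨(1, 0), (gasketSet_iff _ _).2 (Or.inl (Or.inl (.zero_right zero_le_one)))⟩, ?_, ?_⟩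
    · rw [gasketGraph_adj_iff]
      exact Or.inl ⟨0, 0, .origin, Or.inl rfl, Or.inr (Or.inl rfl), by simp [gasketOrigin]⟩
    · simp [gasketOrigin]
  · exact exists_adj_natAbs_lt_of_plus z hz h h0
  · obtain ⟨v, hv, hn⟩ := exists_adj_natAbs_lt_of_plus w hw h h0
    refine ⟨gasketNeg v, (gasketNeg_adj_iff w v).2 hv, ?_⟩
    simpa using hn

/-- This is the `4`-regularity of the graph. -/
theorem gasketLaplacian_const (c : ℝ) (z : Gasket) : gasketLaplacian (fun _ => c) z = 0 := by
  have plus : ∀ (w : Gasket) {x y : ℤ}, (w : ℤ × ℤ) = (x, y) → GasketVertex x y → 0 < x + y →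
      gasketLaplacian (fun _ => c) w = 0 := by
    intro w x y hw h h0
    rw [gasketLaplacian_of_plus (fun _ => c) w hw h h0]
    simp only [cellLaplacian]
    split_ifs <;> ring
  rcases z.cases with rfl | ⟨x, y, h, h0, hz | ⟨w, hw, rfl⟩⟩
  · rw [gasketLaplacian_origin (fun _ => c)]
    ring
  · exact plus z hz h h0
  · rw [gasketLaplacian_gasketNeg]
    exact plus w hw h h0

theorem gasketLaplacian_add_smul (f g : Gasket → ℝ) (c : ℝ) :
    gasketLaplacian (f + c • g) = gasketLaplacian f + c • gasketLaplacian g := by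
  ext z
  simp only [gasketLaplacian, Pi.add_apply, Pi.smul_apply, smul_eq_mul, Finset.sum_add_distrib,
    ← Finset.mul_sum]
  ring

theorem gasketLaplacian_gasketDelta_self (x : Gasket) : gasketLaplacian (gasketDelta x) x = -1 := by
  unfold gasketLaplacian
  rw [Finset.sum_eq_zero]
  · simp [gasketDelta]
  · intro y hy
    rw [SimpleGraph.mem_neighborFinset] at hy
    exact Pi.single_eq_of_ne hy.ne' _

/-! ### Odometers, least action and the maximum principle. -/

theorem odometerAfter_succ (x : ℕ → Gasket) (μ₀ : Gasket → ℝ) (n : ℕ) :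
    odometerAfter x μ₀ (n + 1) =
      odometerAfter x μ₀ n + max (sandAfter x μ₀ n (x n) - 1) 0 • gasketDelta (x n) := by
  ext y
  simp only [odometerAfter, Finset.range_add_one, Finset.filter_insert, Pi.add_apply,
    Pi.smul_apply, smul_eq_mul]
  split_ifs with h
  · subst h
    have hmass : sandAfter x μ₀ n (x n) - sandAfter x μ₀ (n + 1) (x n) =
        max (sandAfter x μ₀ n (x n) - 1) 0 := by
      simp only [sandAfter, topple, Pi.add_apply, Pi.smul_apply, smul_eq_mul,
        gasketLaplacian_gasketDelta_self]
      ring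
    rw [Finset.sum_insert (by simp), hmass, gasketDelta, Pi.single_eq_same, mul_one, add_comm]
  · simp [gasketDelta, Ne.symm h]

theorem sandAfter_eq (x : ℕ → Gasket) (μ₀ : Gasket → ℝ) (n : ℕ) :
    sandAfter x μ₀ n = μ₀ + gasketLaplacian (odometerAfter x μ₀ n) := by
  induction n with
  | zero =>
    ext z
    simp [sandAfter, odometerAfter, gasketLaplacian]
  | succ n ih =>
    rw [odometerAfter_succ, gasketLaplacian_add_smul, ← add_assoc, ← ih]
    rfl

theorem odometerAfter_monotone (x : ℕ → Gasket) (μ₀ : Gasket → ℝ) :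
    Monotone (odometerAfter x μ₀) := by
  refine monotone_nat_of_le_succ fun n y => ?_
  rw [odometerAfter_succ]
  simp only [Pi.add_apply, Pi.smul_apply, smul_eq_mul, le_add_iff_nonneg_right]
  have h : (0 : Gasket → ℝ) ≤ gasketDelta (x n) := Pi.single_nonneg.2 zero_le_one
  exact mul_nonneg (le_max_right _ _) (h y)

/-- The least action principle: the odometer stays below every stabilizing function. -/
theorem odometerAfter_le {μ₀ u : Gasket → ℝ} (hu : ∀ z, 0 ≤ u z)
    (hstab : ∀ z, μ₀ z + gasketLaplacian u z ≤ 1) (x : ℕ → Gasket) (n : ℕ) (z : Gasket) :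
    odometerAfter x μ₀ n z ≤ u z := by
  induction n generalizing z with
  | zero => simpa [odometerAfter] using hu z
  | succ n ih =>
    rw [odometerAfter_succ]
    by_cases h : z = x n
    · subst h
      simp only [Pi.add_apply, Pi.smul_apply, smul_eq_mul, gasketDelta, Pi.single_eq_same, mul_one]
      rcases max_cases (sandAfter x μ₀ n (x n) - 1) 0 with ⟨h, -⟩ | ⟨h, -⟩
      -- The old odometer at the toppled vertex cancels: the new value is `μ₀ - 1` plus the
      -- neighbour average of the old odometer, which is at most the same expression for `u`, hence
      -- at most `u`.
      · rw [h, sandAfter_eq]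
        have h1 := hstab (x n)
        have h2 := Finset.sum_le_sum fun w (_ : w ∈ gasketGraph.neighborFinset (x n)) => ih w
        simp only [gasketLaplacian, Pi.add_apply] at h1 ⊢
        linarith
      · rw [h, add_zero]
        exact ih _
    · simpa [gasketDelta, h] using ih z

/-- The maximum principle on a finite set of vertices. -/
theorem nonpos_of_subharmonic {w : Gasket → ℝ} {D : Set Gasket} (hD : D.Finite)
    (hsub : ∀ z ∈ D, 0 ≤ gasketLaplacian w z) (hout : ∀ z ∉ D, w z ≤ 0) (z : Gasket) :
    w z ≤ 0 := by
  by_contra! hz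
  have hzD : z ∈ D := by
    by_contra h
    exact hz.not_ge (hout z h)
  obtain ⟨m, hmD, hm⟩ := D.exists_max_image w hD ⟨z, hzD⟩
  have hpos : 0 < w m := hz.trans_le (hm z hzD)
  have hmax : ∀ y, w y ≤ w m := fun y => by
    by_cases hy : y ∈ D
    · exact hm y hy
    · exact (hout y hy).trans hpos.le
  have hAD : {y | w y = w m} ⊆ D := fun y hy => by
    by_contra h
    exact hpos.not_ge (le_of_eq_of_le (Eq.symm hy) (hout y h))
  -- Among the maximizers, finitely many because the maximum is positive, take one with largest
  -- `|x|`. Its outward neighbour must be a maximizer as well, a contradiction.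
  obtain ⟨p, hp, hpmax⟩ := Set.exists_max_image {y | w y = w m}
    (fun y : Gasket => (y : ℤ × ℤ).1.natAbs) (hD.subset hAD) ⟨m, rfl⟩
  obtain ⟨q, hpq, hlt⟩ := exists_adj_natAbs_lt p
  have hq : w q = w m := by
    have h1 := hsub p (hAD hp)
    have h2 := gasketLaplacian_const (w m) p
    simp only [gasketLaplacian, Set.mem_ofPred_eq] at h1 h2 hp
    refine le_antisymm (hmax q) ?_
    by_contra! hlt
    have := Finset.sum_lt_sum (s := gasketGraph.neighborFinset p) (f := w) (g := fun _ => w m)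
      (fun y _ => hmax y) ⟨q, by simpa using hpq, hlt⟩
    linarith
  exact (hpmax q hq).not_gt hlt

/-- A nonnegative finitely supported function that stabilizes `μ₀`, and leaves mass exactly `1`
where it is positive, is the odometer function. -/
theorem isOdometer_of_stabilizing {μ₀ u : Gasket → ℝ} (hu : ∀ z, 0 ≤ u z)
    (hfin : (sandpileCluster u).Finite) (hstab : ∀ z, μ₀ z + gasketLaplacian u z ≤ 1)
    (hfull : ∀ z, 0 < u z → μ₀ z + gasketLaplacian u z = 1) : IsOdometer μ₀ u := by
  intro x hx
  have hbdd : ∀ z, BddAbove (Set.range fun n => odometerAfter x μ₀ n z) := fun z =>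
    ⟨u z, by rintro _ ⟨n, rfl⟩; exact odometerAfter_le hu hstab x n z⟩
  set v : Gasket → ℝ := fun z => ⨆ n, odometerAfter x μ₀ n z with hv
  have htend : ∀ z, Tendsto (fun n => odometerAfter x μ₀ n z) atTop (𝓝 (v z)) := fun z =>
    tendsto_atTop_ciSup (fun _ _ h => odometerAfter_monotone x μ₀ h z) (hbdd z)
  have hv0 : ∀ z, 0 ≤ v z := fun z =>
    le_ciSup_of_le (hbdd z) 0 (by simp [odometerAfter])
  have hvstab : ∀ z, μ₀ z + gasketLaplacian v z ≤ 1 := by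
    intro z
    have hlap : Tendsto (fun n => μ₀ z + ((1 / 4) * ∑ y ∈ gasketGraph.neighborFinset z,
        odometerAfter x μ₀ n y) - 1) atTop
        (𝓝 (μ₀ z + ((1 / 4) * ∑ y ∈ gasketGraph.neighborFinset z, v y) - 1)) :=
      ((tendsto_const_nhds.add (tendsto_const_nhds.mul
        (tendsto_finsetSum _ fun y _ => htend y))).sub tendsto_const_nhds)
    -- Just after `z` topples, its odometer is at least `μ₀ z - 1` plus the current neighbour
    -- average. This happens infinitely often, so it survives in the limit.
    have hfreq : ∃ᶠ n in atTop, μ₀ z + ((1 / 4) * ∑ y ∈ gasketGraph.neighborFinset z,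
        odometerAfter x μ₀ n y) - 1 ≤ v z := by
      refine (Nat.frequently_atTop_iff_infinite.2 (hx z)).mono fun n hn => ?_
      refine le_trans ?_ (le_ciSup (hbdd z) (n + 1))
      rw [odometerAfter_succ]
      subst hn
      simp only [Pi.add_apply, Pi.smul_apply, smul_eq_mul, gasketDelta, Pi.single_eq_same, mul_one]
      refine le_trans (le_of_eq ?_) (add_le_add_right (le_max_left _ _) _)
      rw [sandAfter_eq]
      simp only [Pi.add_apply, gasketLaplacian]
      ring
    have := le_of_tendsto_of_frequently hlap hfreq
    simp only [gasketLaplacian]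
    linarith
  have hle : ∀ z, v z ≤ u z := fun z => ciSup_le fun n => odometerAfter_le hu hstab x n z
  -- On the cluster `Δu = 1 - μ₀ ≥ Δv`; off it `u ≤ 0 ≤ v`.
  have hsub : ∀ z, (u + (-1 : ℝ) • v) z ≤ 0 := by
    refine nonpos_of_subharmonic hfin (fun z hz => ?_) (fun z hz => ?_)
    · rw [gasketLaplacian_add_smul]
      have h1 := hfull z hz
      have h2 := hvstab z
      simp only [Pi.add_apply, Pi.smul_apply, smul_eq_mul]
      linarith
    · have h1 : u z ≤ 0 := not_lt.1 hz
      have h2 := hv0 z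
      simp only [Pi.add_apply, Pi.smul_apply, smul_eq_mul]
      linarith
  have heq : v = u := funext fun z => le_antisymm (hle z) (by
    have := hsub z
    simp only [Pi.add_apply, Pi.smul_apply, smul_eq_mul] at this
    linarith)
  exact fun z => heq ▸ htend z

/-! ### Refinement, decimation and uniqueness of `ũ`. -/

/-- On every unit triangle of the gasket, `f` is the refinement of `5 g`: the corners of the doubled
triangle carry `5 g`, and its midpoints carry the values that make the Laplacian equal to `1`. -/
structure IsRefinement (f g : ℤ × ℤ → ℝ) : Prop where
  even : ∀ a b, GasketVertex a b → f (2 * a, 2 * b) = 5 * g (a, b)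
  bottom : ∀ a b, GasketCell a b →
    f (2 * a + 1, 2 * b) = 2 * g (a, b) + 2 * g (a + 1, b) + g (a, b + 1) - 2
  left : ∀ a b, GasketCell a b →
    f (2 * a, 2 * b + 1) = 2 * g (a, b) + g (a + 1, b) + 2 * g (a, b + 1) - 2
  slant : ∀ a b, GasketCell a b →
    f (2 * a + 1, 2 * b + 1) = g (a, b) + 2 * g (a + 1, b) + 2 * g (a, b + 1) - 2

theorem GasketCell.vertex_right {a b : ℤ} (h : GasketCell a b) : GasketVertex (a + 1) b :=
  Or.inr (Or.inl (by simpa using h))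

theorem GasketCell.vertex_up {a b : ℤ} (h : GasketCell a b) : GasketVertex a (b + 1) :=
  Or.inr (Or.inr (by simpa using h))

theorem cellLaplacian_bottom (f : ℤ × ℤ → ℝ) {a b : ℤ} (h : GasketCell a b) :
    cellLaplacian f (2 * a + 1) (2 * b) = f (2 * (a + 1), 2 * b) + f (2 * a + 1, 2 * b + 1) +
      f (2 * a, 2 * b) + f (2 * a, 2 * b + 1) - 4 * f (2 * a + 1, 2 * b) := by
  unfold cellLaplacian
  rw [if_pos ((GasketCell.right_iff rfl rfl).2 h),
    if_pos ((GasketCell.even_iff (a := a) (by omega) rfl).2 h),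
    if_neg (GasketCell.not_odd_odd rfl (y := 2 * b - 1) (b := b - 1) (by omega))]
  ring_nf

theorem cellLaplacian_left (f : ℤ × ℤ → ℝ) {a b : ℤ} (h : GasketCell a b) :
    cellLaplacian f (2 * a) (2 * b + 1) = f (2 * a + 1, 2 * b + 1) + f (2 * a, 2 * (b + 1)) +
      f (2 * a, 2 * b) + f (2 * a + 1, 2 * b) - 4 * f (2 * a, 2 * b + 1) := by
  unfold cellLaplacian
  rw [if_pos ((GasketCell.up_iff rfl rfl).2 h),
    if_pos ((GasketCell.even_iff (b := b) rfl (by omega)).2 h),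
    if_neg (GasketCell.not_odd_odd (x := 2 * a - 1) (a := a - 1) (by omega) rfl)]
  ring_nf

theorem cellLaplacian_slant (f : ℤ × ℤ → ℝ) {a b : ℤ} (h : GasketCell a b) :
    cellLaplacian f (2 * a + 1) (2 * b + 1) = f (2 * a, 2 * b + 1) + f (2 * a, 2 * (b + 1)) +
      f (2 * a + 1, 2 * b) + f (2 * (a + 1), 2 * b) - 4 * f (2 * a + 1, 2 * b + 1) := by
  unfold cellLaplacian
  rw [if_neg (GasketCell.not_odd_odd rfl rfl),
    if_pos ((GasketCell.up_iff (a := a) (by omega) rfl).2 h),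
    if_pos ((GasketCell.right_iff (b := b) rfl (by omega)).2 h)]
  ring_nf

/-- Each triangle at the vertex turns its contribution `t` into `3t - 4`, and there are two
triangles. -/
theorem IsRefinement.cellLaplacian_even {f g : ℤ × ℤ → ℝ} (h : IsRefinement f g) {a b : ℤ}
    (hv : GasketVertex a b) (h0 : 0 < a + b) :
    cellLaplacian f (2 * a) (2 * b) = 3 * cellLaplacian g a b - 8 := by
  have e1 : GasketCell (2 * a) (2 * b) ↔ GasketCell a b := GasketCell.even_iff rfl rfl
  have e2 : GasketCell (2 * a - 1) (2 * b) ↔ GasketCell (a - 1) b :=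
    GasketCell.right_iff (by omega) rfl
  have e3 : GasketCell (2 * a) (2 * b - 1) ↔ GasketCell a (b - 1) :=
    GasketCell.up_iff rfl (by omega)
  have key1 : GasketCell a b → f (2 * a + 1, 2 * b) + f (2 * a, 2 * b + 1) - 2 * f (2 * a, 2 * b) =
      3 * (g (a + 1, b) + g (a, b + 1) - 2 * g (a, b)) - 4 := fun hc => by
    rw [h.even _ _ hv, h.bottom _ _ hc, h.left _ _ hc]
    ring
  have key2 : GasketCell (a - 1) b → f (2 * a - 1, 2 * b) + f (2 * a - 1, 2 * b + 1) -
      2 * f (2 * a, 2 * b) = 3 * (g (a - 1, b) + g (a - 1, b + 1) - 2 * g (a, b)) - 4 :=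
    fun hc => by
    rw [h.even _ _ hv, show 2 * a - 1 = 2 * (a - 1) + 1 by ring, h.bottom _ _ hc, h.slant _ _ hc,
      sub_add_cancel]
    ring
  have key3 : GasketCell a (b - 1) → f (2 * a, 2 * b - 1) + f (2 * a + 1, 2 * b - 1) -
      2 * f (2 * a, 2 * b) = 3 * (g (a, b - 1) + g (a + 1, b - 1) - 2 * g (a, b)) - 4 :=
    fun hc => by
    rw [h.even _ _ hv, show 2 * b - 1 = 2 * (b - 1) + 1 by ring, h.left _ _ hc, h.slant _ _ hc,
      sub_add_cancel]
    ring
  unfold cellLaplacian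
  rcases hv.two_cells h0 with ⟨h1, h2, h3⟩ | ⟨h1, h2, h3⟩ | ⟨h1, h2, h3⟩
  · simp only [e1, e2, e3, h1, h2, h3, if_true, if_false, key1 h1, key2 h2]
    ring
  · simp only [e1, e2, e3, h1, h2, h3, if_true, if_false, key1 h1, key3 h3]
    ring
  · simp only [e1, e2, e3, h1, h2, h3, if_true, if_false, key2 h2, key3 h3]
    ring

theorem gasketVertex_row_one {x : ℤ} (hx : 0 ≤ x) : GasketVertex x 1 :=
  Or.inr (Or.inr (GasketCell.zero_right hx))

theorem isUTilde_iff (f : ℤ × ℤ → ℝ) : IsUTilde f ↔ (∀ x : ℤ, 0 ≤ x → f (x, 0) = 0) ∧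
    (∀ x : ℤ, 0 ≤ x → f (x, 1) = 2) ∧
    ∀ x y : ℤ, GasketVertex x y → 1 ≤ y → cellLaplacian f x y = 4 := by
  have lap : ∀ (z : Gasket) (x y : ℤ), (z : ℤ × ℤ) = (x, y) → GasketVertex x y → 1 ≤ y →
      (gasketLaplacian (fun w => f w) z = 1 ↔ cellLaplacian f x y = 4) := by
    intro z x y hz h hy
    have := h.nonneg
    rw [gasketLaplacian_of_plus f z hz h (by omega)]
    constructor <;> intro h <;> linarith
  constructor
  · intro h
    refine ⟨h.row_zero,
      fun x hx => h.row_one x hx ((mem_gasketPlus_iff _ _).2 (gasketVertex_row_one hx)), ?_⟩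
    intro x y hv hy
    have hm := (mem_gasketPlus_iff x y).2 hv
    exact (lap ⟨(x, y), Or.inl hm⟩ x y rfl hv hy).1 (h.laplacian_eq_one _ hm hy)
  · rintro ⟨h0, h1, h2⟩
    refine ⟨h0, fun x hx _ => h1 x hx, ?_⟩
    rintro ⟨⟨x, y⟩, hz⟩ hp hy
    have hv := (mem_gasketPlus_iff x y).1 hp
    exact (lap _ x y rfl hv hy).2 (h2 x y hv hy)

/-- The equation at `(2x, 1)` has this value as its only unknown. That it is `5 · 2` makes row one
of the decimation equal to `2`. -/
theorem IsUTilde.row_two {f : ℤ × ℤ → ℝ} (hf : IsUTilde f) {x : ℤ} (hx : 0 ≤ x) :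
    f (2 * x, 2) = 10 := by
  obtain ⟨h0, h1, h2⟩ := (isUTilde_iff f).1 hf
  have h := h2 (2 * x) (2 * 0 + 1) (gasketVertex_row_one (by omega)) (by omega)
  rw [cellLaplacian_left f (GasketCell.zero_right hx)] at h
  simp only [mul_zero, zero_add, mul_one] at h
  rw [h0 _ (by omega), h0 _ (by omega), h1 _ (by omega), h1 _ (by omega)] at h
  linarith

/-- A solution is the refinement of its own decimation. -/
theorem IsUTilde.isRefinement {f : ℤ × ℤ → ℝ} (hf : IsUTilde f) :
    IsRefinement f (fun z => f (2 * z.1, 2 * z.2) / 5) := by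
  obtain ⟨h0, h1, h2⟩ := (isUTilde_iff f).1 hf
  have mid : ∀ a b, GasketCell a b →
      f (2 * a + 1, 2 * b) = (2 * f (2 * a, 2 * b) + 2 * f (2 * (a + 1), 2 * b) +
        f (2 * a, 2 * (b + 1))) / 5 - 2 ∧
      f (2 * a, 2 * b + 1) = (2 * f (2 * a, 2 * b) + f (2 * (a + 1), 2 * b) +
        2 * f (2 * a, 2 * (b + 1))) / 5 - 2 ∧
      f (2 * a + 1, 2 * b + 1) = (f (2 * a, 2 * b) + 2 * f (2 * (a + 1), 2 * b) +
        2 * f (2 * a, 2 * (b + 1))) / 5 - 2 := by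
    intro a b hc
    have hn := hc.nonneg
    -- For `b = 0` the bottom midpoint lies in row zero, where no equation is imposed, so the
    -- prescribed rows are used instead. For `b > 0` the three midpoint equations form a uniquely
    -- solvable linear system.
    rcases hn.2.eq_or_lt with rfl | hb
    · simp only [mul_zero, zero_add, mul_one]
      rw [h0 _ (by omega), h0 _ (by omega), h0 _ (by omega), h1 _ (by omega), h1 _ (by omega),
        hf.row_two hn.1]
      norm_num
    · have e1 := h2 _ _ (Or.inl hc.right) (by omega)
      have e2 := h2 _ _ (Or.inl hc.up) (by omega)
      have e3 := h2 (2 * a + 1) (2 * b + 1)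
        (Or.inr (Or.inl ((GasketCell.up_iff (a := a) (by omega) rfl).2 hc))) (by omega)
      rw [cellLaplacian_bottom f hc] at e1
      rw [cellLaplacian_left f hc] at e2
      rw [cellLaplacian_slant f hc] at e3
      refine ⟨?_, ?_, ?_⟩ <;> linarith
  refine ⟨fun a b _ => by simp only; ring, fun a b hc => ?_, fun a b hc => ?_, fun a b hc => ?_⟩
  · rw [(mid a b hc).1]; ring
  · rw [(mid a b hc).2.1]; ring
  · rw [(mid a b hc).2.2]; ring

theorem IsUTilde.decimate {f : ℤ × ℤ → ℝ} (hf : IsUTilde f) :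
    IsUTilde (fun z => f (2 * z.1, 2 * z.2) / 5) := by
  have href := hf.isRefinement
  obtain ⟨h0, -, h2⟩ := (isUTilde_iff f).1 hf
  rw [isUTilde_iff]
  refine ⟨fun x hx => ?_, fun x hx => ?_, fun x y hv hy => ?_⟩
  · simp only [mul_zero]
    rw [h0 _ (by omega), zero_div]
  · simp only [mul_one]
    rw [hf.row_two hx]
    norm_num
  · have := hv.nonneg
    have h := href.cellLaplacian_even hv (by omega)
    rw [h2 (2 * x) (2 * y) ?_ (by omega)] at h
    · linarith
    · rcases hv with hv | hv | hv
      · exact Or.inl hv.even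
      · exact Or.inr (Or.inl ((GasketCell.right_iff (by omega) rfl).2 hv))
      · exact Or.inr (Or.inr ((GasketCell.up_iff rfl (by omega)).2 hv))

/-- Infinite descent: the induction varies `f` and `g`, since it is applied to their decimations.
Rows zero and one are settled first because for `y ≥ 2` the halved corners have strictly smaller
coordinate sum, whereas `(0, 1)` would return to itself. -/
theorem IsUTilde.unique {x y : ℤ} (hv : GasketVertex x y) {f g : ℤ × ℤ → ℝ} (hf : IsUTilde f)
    (hg : IsUTilde g) : f (x, y) = g (x, y) := by
  induction n : x.toNat + y.toNat using Nat.strong_induction_on generalizing x y f g with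
  | _ n ih =>
    subst n
    obtain ⟨f0, f1, -⟩ := (isUTilde_iff f).1 hf
    obtain ⟨g0, g1, -⟩ := (isUTilde_iff g).1 hg
    have hn := hv.nonneg
    obtain rfl | rfl | hy : y = 0 ∨ y = 1 ∨ 2 ≤ y := by omega
    · rw [f0 x hn.1, g0 x hn.1]
    · rw [f1 x hn.1, g1 x hn.1]
    have rf := hf.isRefinement
    have rg := hg.isRefinement
    have df := hf.decimate
    have dg := hg.decimate
    obtain ⟨a, b, ⟨h', rfl, rfl⟩ | ⟨h', ⟨rfl, rfl⟩ | ⟨rfl, rfl⟩ | ⟨rfl, rfl⟩⟩⟩ := hv.cases_half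
    · rw [rf.even a b h', rg.even a b h', ih _ (by omega) h' df dg rfl]
    all_goals
      have e1 := ih _ (by omega) (Or.inl h') df dg rfl
      have e2 := ih _ (by omega) h'.vertex_right df dg rfl
      have e3 := ih _ (by omega) h'.vertex_up df dg rfl
    · rw [rf.bottom a b h', rg.bottom a b h', e1, e2, e3]
    · rw [rf.left a b h', rg.left a b h', e1, e2, e3]
    · rw [rf.slant a b h', rg.slant a b h', e1, e2, e3]

/-! ### Existence, positivity and apex values of `ũ`. -/

/-- The recursive solution, on pairs of natural numbers. -/
noncomputable def uTildeNat (x y : ℕ) : ℝ :=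
  if y = 0 then 0
  else if y = 1 then 2
  else if x % 2 = 0 then
    if y % 2 = 0 then 5 * uTildeNat (x / 2) (y / 2)
    else 2 * uTildeNat (x / 2) (y / 2) + uTildeNat (x / 2 + 1) (y / 2) +
      2 * uTildeNat (x / 2) (y / 2 + 1) - 2
  else
    if y % 2 = 0 then 2 * uTildeNat (x / 2) (y / 2) + 2 * uTildeNat (x / 2 + 1) (y / 2) +
      uTildeNat (x / 2) (y / 2 + 1) - 2
    else uTildeNat (x / 2) (y / 2) + 2 * uTildeNat (x / 2 + 1) (y / 2) +
      2 * uTildeNat (x / 2) (y / 2 + 1) - 2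
termination_by x + y
decreasing_by all_goals omega

/-- The function `ũ`. -/
noncomputable def uTilde (z : ℤ × ℤ) : ℝ := uTildeNat z.1.toNat z.2.toNat

theorem uTilde_row_zero (x : ℤ) : uTilde (x, 0) = 0 := by
  unfold uTilde uTildeNat
  simp

theorem uTilde_row_one (x : ℤ) : uTilde (x, 1) = 2 := by
  unfold uTilde uTildeNat
  simp

/-- The base rows `0` and `2` themselves satisfy the refinement formulas, so these hold without
exception for `b = 0`. -/
theorem uTilde_even {a b : ℤ} (ha : 0 ≤ a) (hb : 0 ≤ b) :
    uTilde (2 * a, 2 * b) = 5 * uTilde (a, b) := by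
  rcases hb.eq_or_lt with rfl | hb
  · rw [mul_zero, uTilde_row_zero, uTilde_row_zero, mul_zero]
  lift a to ℕ using ha
  lift b to ℕ using hb.le
  have e1 : (2 * (a : ℤ)).toNat = 2 * a := by omega
  have e2 : (2 * (b : ℤ)).toNat = 2 * b := by omega
  simp only [uTilde, e1, e2, Int.toNat_natCast]
  rw [uTildeNat, if_neg (by omega), if_neg (by omega), if_pos (by omega), if_pos (by omega)]
  simp

theorem uTilde_left {a b : ℤ} (ha : 0 ≤ a) (hb : 0 ≤ b) : uTilde (2 * a, 2 * b + 1) =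
    2 * uTilde (a, b) + uTilde (a + 1, b) + 2 * uTilde (a, b + 1) - 2 := by
  rcases hb.eq_or_lt with rfl | hb
  · simp only [mul_zero, zero_add, uTilde_row_zero, uTilde_row_one]
    norm_num
  lift a to ℕ using ha
  lift b to ℕ using hb.le
  have e1 : (2 * (a : ℤ)).toNat = 2 * a := by omega
  have e2 : (2 * (b : ℤ) + 1).toNat = 2 * b + 1 := by omega
  simp only [uTilde, e1, e2, Int.toNat_natCast, Int.toNat_natCast_add_one]
  rw [uTildeNat, if_neg (by omega), if_neg (by omega), if_pos (by omega), if_neg (by omega)]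
  rw [show 2 * a / 2 = a by omega, show (2 * b + 1) / 2 = b by omega]

theorem uTilde_bottom {a b : ℤ} (ha : 0 ≤ a) (hb : 0 ≤ b) : uTilde (2 * a + 1, 2 * b) =
    2 * uTilde (a, b) + 2 * uTilde (a + 1, b) + uTilde (a, b + 1) - 2 := by
  rcases hb.eq_or_lt with rfl | hb
  · simp only [mul_zero, zero_add, uTilde_row_zero, uTilde_row_one]
    norm_num
  lift a to ℕ using ha
  lift b to ℕ using hb.le
  have e1 : (2 * (a : ℤ) + 1).toNat = 2 * a + 1 := by omega
  have e2 : (2 * (b : ℤ)).toNat = 2 * b := by omega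
  simp only [uTilde, e1, e2, Int.toNat_natCast, Int.toNat_natCast_add_one]
  rw [uTildeNat, if_neg (by omega), if_neg (by omega), if_neg (by omega), if_pos (by omega)]
  rw [show (2 * a + 1) / 2 = a by omega, show 2 * b / 2 = b by omega]

theorem uTilde_slant {a b : ℤ} (ha : 0 ≤ a) (hb : 0 ≤ b) : uTilde (2 * a + 1, 2 * b + 1) =
    uTilde (a, b) + 2 * uTilde (a + 1, b) + 2 * uTilde (a, b + 1) - 2 := by
  rcases hb.eq_or_lt with rfl | hb
  · simp only [mul_zero, zero_add, uTilde_row_zero, uTilde_row_one]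
    norm_num
  lift a to ℕ using ha
  lift b to ℕ using hb.le
  have e1 : (2 * (a : ℤ) + 1).toNat = 2 * a + 1 := by omega
  have e2 : (2 * (b : ℤ) + 1).toNat = 2 * b + 1 := by omega
  simp only [uTilde, e1, e2, Int.toNat_natCast, Int.toNat_natCast_add_one]
  rw [uTildeNat, if_neg (by omega), if_neg (by omega), if_neg (by omega), if_neg (by omega)]
  rw [show (2 * a + 1) / 2 = a by omega, show (2 * b + 1) / 2 = b by omega]

theorem uTilde_isRefinement : IsRefinement uTilde uTilde where
  even _ _ h := uTilde_even h.nonneg.1 h.nonneg.2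
  bottom _ _ h := uTilde_bottom h.nonneg.1 h.nonneg.2
  left _ _ h := uTilde_left h.nonneg.1 h.nonneg.2
  slant _ _ h := uTilde_slant h.nonneg.1 h.nonneg.2

/-- At midpoints the equation is an identity in the corner values; at doubled vertices `3 · 4 - 8 =
4`. -/
theorem uTilde_cellLaplacian {x y : ℤ} (hv : GasketVertex x y) (hy : 1 ≤ y) :
    cellLaplacian uTilde x y = 4 := by
  induction n : x.toNat + y.toNat using Nat.strong_induction_on generalizing x y with
  | _ n ih =>
    subst n
    have hn := hv.nonneg
    obtain ⟨a, b, ⟨h', rfl, rfl⟩ | ⟨h', h⟩⟩ := hv.cases_half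
    · rw [uTilde_isRefinement.cellLaplacian_even h' (by omega), ih _ (by omega) h' (by omega) rfl]
      norm_num
    · have r := uTilde_isRefinement
      have e1 := r.even a b (Or.inl h')
      have e2 := r.even _ _ h'.vertex_right
      have e3 := r.even _ _ h'.vertex_up
      have m1 := r.bottom a b h'
      have m2 := r.left a b h'
      have m3 := r.slant a b h'
      obtain ⟨rfl, rfl⟩ | ⟨rfl, rfl⟩ | ⟨rfl, rfl⟩ := h
      · rw [cellLaplacian_bottom _ h', e1, e2, m1, m2, m3]; ring
      · rw [cellLaplacian_left _ h', e1, e3, m1, m2, m3]; ring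
      · rw [cellLaplacian_slant _ h', e2, e3, m1, m2, m3]; ring

theorem isUTilde_uTilde : IsUTilde uTilde :=
  (isUTilde_iff _).2 ⟨fun x _ => uTilde_row_zero x, fun x _ => uTilde_row_one x,
    fun _ _ => uTilde_cellLaplacian⟩

/-- The coefficients in each refinement formula sum to `5`, and `5 · 2 - 2 ≥ 2`. -/
theorem two_le_uTilde {x y : ℤ} (hx : 0 ≤ x) (hy : 1 ≤ y) : 2 ≤ uTilde (x, y) := by
  induction n : x.toNat + y.toNat using Nat.strong_induction_on generalizing x y with
  | _ n ih =>
    subst n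
    obtain rfl | hy2 : y = 1 ∨ 2 ≤ y := by omega
    · rw [uTilde_row_one]
    obtain ⟨a, ha⟩ := Int.even_or_odd' x
    obtain ⟨b, hb⟩ := Int.even_or_odd' y
    have e1 := ih _ (by omega) (x := a) (y := b) (by omega) (by omega) rfl
    rcases ha with rfl | rfl <;> rcases hb with rfl | rfl
    · rw [uTilde_even (by omega) (by omega)]
      linarith
    all_goals
      have e2 := ih _ (by omega) (x := a + 1) (y := b) (by omega) (by omega) rfl
      have e3 := ih _ (by omega) (x := a) (y := b + 1) (by omega) (by omega) rfl
    · rw [uTilde_left (by omega) (by omega)]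
      linarith
    · rw [uTilde_bottom (by omega) (by omega)]
      linarith
    · rw [uTilde_slant (by omega) (by omega)]
      linarith

/-- These points are the images under `ψ_k` of the origin and its neighbours in `SG⁺`. The
difference `d` between the apex value and the other two satisfies `d ↦ 3d + 2`, starting from `2`,
so `d = 3^(k+1) - 1`. -/
theorem uTilde_apex (k : ℕ) : uTilde (0, 2 ^ k) = 2 * 5 ^ k ∧
    uTilde (0, 2 ^ k - 1) = 2 * 5 ^ k - 3 * 3 ^ k + 1 ∧
    uTilde (1, 2 ^ k - 1) = 2 * 5 ^ k - 3 * 3 ^ k + 1 := by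
  induction k with
  | zero =>
    simp only [pow_zero, sub_self, uTilde_row_zero, uTilde_row_one]
    norm_num
  | succ k ih =>
    obtain ⟨h1, h2, h3⟩ := ih
    have hp : (1 : ℤ) ≤ 2 ^ k := one_le_pow₀ one_le_two
    have e := uTilde_even (a := 0) (b := 2 ^ k) le_rfl (by omega)
    have l := uTilde_left (a := 0) (b := 2 ^ k - 1) le_rfl (by omega)
    have s := uTilde_slant (a := 0) (b := 2 ^ k - 1) le_rfl (by omega)
    simp only [mul_zero, zero_add, sub_add_cancel] at e l s
    rw [show (2 : ℤ) ^ (k + 1) - 1 = 2 * (2 ^ k - 1) + 1 by ring, pow_succ' (2 : ℤ), e, l, s,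
      h1, h2, h3]
    refine ⟨?_, ?_, ?_⟩ <;> ring

/-! ### The candidate odometer and its Laplacian. -/

/-- The odometer function on `ℤ × ℤ`. -/
noncomputable def gasketOdometer (k : ℕ) (z : ℤ × ℤ) : ℝ :=
  if |z.1| + |z.2| ≤ 2 ^ k then uTilde (gasketPsi k (|z.1|, |z.2|)) else 0

theorem gasketOdometer_neg (k : ℕ) (z : ℤ × ℤ) : gasketOdometer k (-z) = gasketOdometer k z := by
  simp [gasketOdometer]

theorem gasketOdometer_of_nonneg (k : ℕ) {x y : ℤ} (hx : 0 ≤ x) (hy : 0 ≤ y)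
    (h : x + y ≤ 2 ^ k) : gasketOdometer k (x, y) = uTilde (y, 2 ^ k - x - y) := by
  simp [gasketOdometer, gasketPsi, abs_of_nonneg hx, abs_of_nonneg hy, h]

theorem gasketOdometer_eq_zero (k : ℕ) {x y : ℤ} (hx : 0 ≤ x) (hy : 0 ≤ y)
    (h : 2 ^ k ≤ x + y) : gasketOdometer k (x, y) = 0 := by
  rcases h.eq_or_lt with h | h
  · rw [gasketOdometer_of_nonneg k hx hy h.ge, show (2 : ℤ) ^ k - x - y = 0 by omega,
      uTilde_row_zero]
  · simp only [gasketOdometer, abs_of_nonneg hx, abs_of_nonneg hy, if_neg h.not_ge]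

theorem gasketOdometer_pos_iff (k : ℕ) (z : ℤ × ℤ) :
    0 < gasketOdometer k z ↔ |z.1| + |z.2| < 2 ^ k := by
  have h1 := abs_nonneg z.1
  have h2 := abs_nonneg z.2
  unfold gasketOdometer gasketPsi
  rcases lt_trichotomy (|z.1| + |z.2|) (2 ^ k) with h | h | h
  · rw [if_pos h.le]
    exact iff_of_true (two_pos.trans_le (two_le_uTilde h2 (by simp only; omega))) h
  · rw [if_pos h.le, show (2 : ℤ) ^ k - (|z.1|, |z.2|).1 - (|z.1|, |z.2|).2 = 0 by
      simp only; omega, uTilde_row_zero]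
    exact iff_of_false (lt_irrefl _) h.not_lt
  · rw [if_neg h.not_ge]
    exact iff_of_false (lt_irrefl _) h.not_gt

theorem gasketOdometer_nonneg (k : ℕ) (z : ℤ × ℤ) : 0 ≤ gasketOdometer k z := by
  by_cases h : |z.1| + |z.2| < 2 ^ k
  · exact ((gasketOdometer_pos_iff k z).2 h).le
  · have h1 := abs_nonneg z.1
    have h2 := abs_nonneg z.2
    unfold gasketOdometer gasketPsi
    split_ifs with h3
    · rw [show (2 : ℤ) ^ k - (|z.1|, |z.2|).1 - (|z.1|, |z.2|).2 = 0 by simp only; omega,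
        uTilde_row_zero]
    · exact le_rfl

/-- The rotation `ψ_k` carries the two triangles at `(x, y)` to the two triangles at its image,
permuting the three possible positions cyclically. -/
theorem cellLaplacian_gasketOdometer_of_lt (k : ℕ) {x y : ℤ} (hv : GasketVertex x y)
    (h0 : 0 < x + y) (h : x + y < 2 ^ k) : cellLaplacian (gasketOdometer k) x y = 4 := by
  have hn := hv.nonneg
  have hv' := hv.rotate (k := k) h.le
  rw [← uTilde_cellLaplacian hv' (by omega)]
  have e1 : GasketCell x y ↔ GasketCell y (2 ^ k - x - y - 1) :=
    GasketCell.rotate_iff (k := k) hn.1 hn.2 (by omega) (by ring)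
  have e2 : GasketCell (x - 1) y ↔ GasketCell y (2 ^ k - x - y) := by
    rcases hn.1.eq_or_lt with rfl | hx
    · refine iff_of_false (fun h => by have := h.nonneg; omega) (fun h' => ?_)
      -- For `x = 0` the coordinates sum to `2^k` with `0 < y < 2^k`. Such a triangle lies in none
      -- of the three translates of `G_k`.
      rcases (GasketCell.lt_two_pow_succ_iff k _ _).1 ⟨h', by rw [pow_succ]; omega⟩ with
        ⟨-, h2⟩ | ⟨h2, -⟩ | ⟨h2, -⟩
      · omega
      · have := h2.nonneg; omega
      · have := h2.nonneg; omega
    · exact GasketCell.rotate_iff (k := k) (by omega) hn.2 (by omega) (by ring)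
  have e3 : GasketCell x (y - 1) ↔ GasketCell (y - 1) (2 ^ k - x - y) := by
    rcases hn.2.eq_or_lt with rfl | hy
    · exact iff_of_false (fun h => by have := h.nonneg; omega)
        (fun h => by have := h.nonneg; omega)
    · exact GasketCell.rotate_iff (k := k) hn.1 (by omega) (by omega) (by ring)
  have o : gasketOdometer k (x, y) = uTilde (y, 2 ^ k - x - y) :=
    gasketOdometer_of_nonneg k hn.1 hn.2 h.le
  have t1 : GasketCell x y → gasketOdometer k (x + 1, y) = uTilde (y, 2 ^ k - x - y - 1) ∧
      gasketOdometer k (x, y + 1) = uTilde (y + 1, 2 ^ k - x - y - 1) := fun _ => by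
    rw [gasketOdometer_of_nonneg k (by omega) hn.2 (by omega),
      gasketOdometer_of_nonneg k hn.1 (by omega) (by omega)]
    constructor <;> congr 2 <;> ring
  have t2 : GasketCell (x - 1) y → gasketOdometer k (x - 1, y) = uTilde (y, 2 ^ k - x - y + 1) ∧
      gasketOdometer k (x - 1, y + 1) = uTilde (y + 1, 2 ^ k - x - y) := fun hc => by
    have := hc.nonneg
    rw [gasketOdometer_of_nonneg k (by omega) hn.2 (by omega),
      gasketOdometer_of_nonneg k (by omega) (by omega) (by omega)]
    constructor <;> congr 2 <;> ring
  have t3 : GasketCell x (y - 1) →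
      gasketOdometer k (x, y - 1) = uTilde (y - 1, 2 ^ k - x - y + 1) ∧
      gasketOdometer k (x + 1, y - 1) = uTilde (y - 1, 2 ^ k - x - y) := fun hc => by
    have := hc.nonneg
    rw [gasketOdometer_of_nonneg k (by omega) (by omega) (by omega),
      gasketOdometer_of_nonneg k (by omega) (by omega) (by omega)]
    constructor <;> congr 2 <;> ring
  unfold cellLaplacian
  rcases hv.two_cells h0 with ⟨h1, h2, h3⟩ | ⟨h1, h2, h3⟩ | ⟨h1, h2, h3⟩
  · rw [if_pos h1, if_pos h2, if_neg h3, if_pos (e2.1 h2), if_neg (mt e3.2 h3), if_pos (e1.1 h1),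
      o, (t1 h1).1, (t1 h1).2, (t2 h2).1, (t2 h2).2]
    ring
  · rw [if_pos h1, if_neg h2, if_pos h3, if_neg (mt e2.2 h2), if_pos (e3.1 h3), if_pos (e1.1 h1),
      o, (t1 h1).1, (t1 h1).2, (t3 h3).1, (t3 h3).2]
    ring
  · rw [if_neg h1, if_pos h2, if_pos h3, if_pos (e2.1 h2), if_pos (e3.1 h3), if_neg (mt e1.2 h1),
      o, (t2 h2).1, (t2 h2).2, (t3 h3).1, (t3 h3).2]
    ring

/-- On and outside the sphere of radius `2^k` the function vanishes, and each of the at most two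
triangles reaching inwards contributes at most the row-one value `2`. -/
theorem cellLaplacian_gasketOdometer_le (k : ℕ) {x y : ℤ} (hv : GasketVertex x y)
    (h0 : 0 < x + y) : cellLaplacian (gasketOdometer k) x y ≤ 4 := by
  rcases lt_or_ge (x + y) (2 ^ k) with h | h
  · exact (cellLaplacian_gasketOdometer_of_lt k hv h0 h).le
  have hn := hv.nonneg
  have near : ∀ s t : ℤ, 0 ≤ s → 0 ≤ t → s + t + 1 = x + y → gasketOdometer k (s, t) ≤ 2 := by
    intro s t hs ht hst
    rcases h.eq_or_lt with h | h
    · rw [gasketOdometer_of_nonneg k hs ht (by omega), show (2 : ℤ) ^ k - s - t = 1 by omega,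
        uTilde_row_one]
    · rw [gasketOdometer_eq_zero k hs ht (by omega)]
      exact two_pos.le
  have far : ∀ s t : ℤ, 0 ≤ s → 0 ≤ t → x + y ≤ s + t → gasketOdometer k (s, t) = 0 :=
    fun s t hs ht hst => gasketOdometer_eq_zero k hs ht (by omega)
  unfold cellLaplacian
  rw [far x y hn.1 hn.2 le_rfl]
  have b1 := far (x + 1) y (by omega) hn.2 (by omega)
  have b2 := far x (y + 1) hn.1 (by omega) (by omega)
  have b3 : GasketCell (x - 1) y → gasketOdometer k (x - 1, y) ≤ 2 ∧
      gasketOdometer k (x - 1, y + 1) = 0 := fun hc => by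
    have := hc.nonneg
    exact ⟨near _ _ (by omega) (by omega) (by omega), far _ _ (by omega) (by omega) (by omega)⟩
  have b4 : GasketCell x (y - 1) → gasketOdometer k (x, y - 1) ≤ 2 ∧
      gasketOdometer k (x + 1, y - 1) = 0 := fun hc => by
    have := hc.nonneg
    exact ⟨near _ _ (by omega) (by omega) (by omega), far _ _ (by omega) (by omega) (by omega)⟩
  rw [b1, b2]
  split_ifs with h1 h2 h3 h3 h2 h3 h3
  all_goals
    first
    | have := b3 h2
    | skip
    first
    | have := b4 h3
    | skip
    linarith

theorem gasketLaplacian_gasketOdometer_origin (k : ℕ) :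
    gasketLaplacian (fun z => gasketOdometer k z) gasketOrigin = 1 - 3 ^ (k + 1) := by
  have hp : (1 : ℤ) ≤ 2 ^ k := one_le_pow₀ one_le_two
  obtain ⟨h1, h2, h3⟩ := uTilde_apex k
  have e0 := gasketOdometer_of_nonneg k (x := 0) (y := 0) le_rfl le_rfl (by omega)
  have e1 := gasketOdometer_of_nonneg k (x := 1) (y := 0) zero_le_one le_rfl (by omega)
  have e2 := gasketOdometer_of_nonneg k (x := 0) (y := 1) le_rfl zero_le_one (by omega)
  have e3 := gasketOdometer_neg k (1, 0)
  have e4 := gasketOdometer_neg k (0, 1)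
  simp only [sub_zero, Prod.neg_mk, neg_zero] at e0 e1 e2 e3 e4
  rw [gasketLaplacian_origin, e3, e4, e0, e1, e2, h1, h2, h3]
  ring

theorem abs_add_abs_eq_gasketNorm (z : ℤ × ℤ) : |z.1| + |z.2| = gasketNorm z := by
  simp [gasketNorm]

theorem gasketLaplacian_gasketOdometer (k : ℕ) (z : Gasket) (hz : z ≠ gasketOrigin) :
    gasketLaplacian (fun w => gasketOdometer k w) z ≤ 1 ∧
      (0 < gasketOdometer k z → gasketLaplacian (fun w => gasketOdometer k w) z = 1) := by
  have plus : ∀ (w : Gasket) {x y : ℤ}, (w : ℤ × ℤ) = (x, y) → GasketVertex x y → 0 < x + y →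
      gasketLaplacian (fun w => gasketOdometer k w) w ≤ 1 ∧
      (0 < gasketOdometer k w → gasketLaplacian (fun w => gasketOdometer k w) w = 1) := by
    intro w x y hw h h0
    rw [gasketLaplacian_of_plus _ w hw h h0, gasketOdometer_pos_iff, hw]
    have hn := h.nonneg
    simp only [abs_of_nonneg hn.1, abs_of_nonneg hn.2]
    refine ⟨by linarith [cellLaplacian_gasketOdometer_le k h h0], fun hlt => ?_⟩
    rw [cellLaplacian_gasketOdometer_of_lt k h h0 hlt]
    norm_num
  rcases z.cases with h | ⟨x, y, h, h0, hz | ⟨w, hw, rfl⟩⟩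
  · exact absurd h hz
  · exact plus z hz h h0
  · rw [gasketLaplacian_gasketNeg]
    simp only [coe_gasketNeg, gasketOdometer_neg]
    exact plus w hw h h0

theorem isOdometer_gasketOdometer (k : ℕ) :
    IsOdometer ((3 : ℝ) ^ (k + 1) • gasketDelta gasketOrigin) (fun z => gasketOdometer k z) := by
  have key : ∀ z, ((3 : ℝ) ^ (k + 1) • gasketDelta gasketOrigin) z +
      gasketLaplacian (fun w => gasketOdometer k w) z ≤ 1 ∧ (0 < gasketOdometer k z →
      ((3 : ℝ) ^ (k + 1) • gasketDelta gasketOrigin) z +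
        gasketLaplacian (fun w => gasketOdometer k w) z = 1) := by
    intro z
    by_cases hz : z = gasketOrigin
    · rw [hz, gasketLaplacian_gasketOdometer_origin]
      simp [gasketDelta]
    · simpa [gasketDelta, hz] using gasketLaplacian_gasketOdometer k z hz
  refine isOdometer_of_stabilizing (fun z => gasketOdometer_nonneg k z) ?_
    (fun z => (key z).1) (fun z => (key z).2)
  refine Set.Finite.of_finite_image (f := Subtype.val) ?_ Subtype.val_injective.injOn
  refine ((Set.finite_Icc (-(2 ^ k : ℤ)) (2 ^ k)).prod
    (Set.finite_Icc (-(2 ^ k : ℤ)) (2 ^ k))).subset ?_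
  rintro _ ⟨z, hz, rfl⟩
  have h := (gasketOdometer_pos_iff k z).1 hz
  have h1 := abs_nonneg (z : ℤ × ℤ).1
  have h2 := abs_nonneg (z : ℤ × ℤ).2
  simp only [Set.mem_prod, Set.mem_Icc, ← abs_le]
  omega

theorem gasketPsi_mem_gasketPlus (k : ℕ) (z : Gasket)
    (h : |(z : ℤ × ℤ).1| + |(z : ℤ × ℤ).2| ≤ 2 ^ k) :
    gasketPsi k (|(z : ℤ × ℤ).1|, |(z : ℤ × ℤ).2|) ∈ gasketPlus := by
  obtain ⟨⟨x, y⟩, hz⟩ := z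
  have hv : GasketVertex |x| |y| := by
    rcases (gasketSet_iff x y).1 hz with h | h <;> have hn := h.nonneg
    · rwa [abs_of_nonneg hn.1, abs_of_nonneg hn.2]
    · rwa [← abs_neg x, ← abs_neg y, abs_of_nonneg hn.1, abs_of_nonneg hn.2]
  exact (mem_gasketPlus_iff _ _).2 (hv.rotate h)

open Classical in
theorem mainTheorem3 :
    (∃ ut : ℤ × ℤ → ℝ, IsUTilde ut ∧ ∀ f, IsUTilde f → Set.EqOn f ut gasketPlus) ∧
    ∀ ut : ℤ × ℤ → ℝ, IsUTilde ut → ∀ k : ℕ,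
      ∃ u : Gasket → ℝ, IsOdometer ((3 : ℝ) ^ (k + 1) • gasketDelta gasketOrigin) u ∧
        (∀ z : Gasket, u z =
          if z ∈ gasketBall (2 ^ k) then
            ut (gasketPsi k (|(z : ℤ × ℤ).1|, |(z : ℤ × ℤ).2|))
          else 0) ∧
        sandpileCluster u = gasketBall (2 ^ k - 1) := by
  refine ⟨⟨uTilde, isUTilde_uTilde, ?_⟩, ?_⟩
  · rintro f hf ⟨x, y⟩ hz
    exact hf.unique ((mem_gasketPlus_iff x y).1 hz) isUTilde_uTilde
  · intro ut hut k
    refine ⟨fun z => gasketOdometer k z, isOdometer_gasketOdometer k, fun z => ?_, ?_⟩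
    · have hball : z ∈ gasketBall (2 ^ k) ↔ |(z : ℤ × ℤ).1| + |(z : ℤ × ℤ).2| ≤ 2 ^ k := by
        rw [mem_gasketBall_iff, abs_add_abs_eq_gasketNorm]
        exact_mod_cast Iff.rfl
      simp only [hball, gasketOdometer]
      split_ifs with h
      · have hm := gasketPsi_mem_gasketPlus k z h
        exact (hut.unique ((mem_gasketPlus_iff _ _).1 hm) isUTilde_uTilde).symm
      · rfl
    · ext z
      have hp : 0 < 2 ^ k := by positivity
      have hnorm := abs_add_abs_eq_gasketNorm z
      change 0 < gasketOdometer k z ↔ _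
      -- The radius `2^k - 1` is a natural subtraction, harmless because `2^k` is positive.
      rw [gasketOdometer_pos_iff, mem_gasketBall_iff, hnorm, ← Nat.lt_iff_le_pred hp]
      exact_mod_cast Iff.rfl
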